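/- Let $m,n\ge 1$. A state on $\mathcal B(\mathbb C^m\otimes\mathbb C^n)=\mathcal B(\mathbb C^m)\otimes\mathcal B(\mathbb C^n)$ is a linear functional that is nonnegative on positive semidefinite operators and takes the value $1$ at the identity; let $K_{m,n}$ be the convex set of all these states. A product state is a state $\omega_1\otimes\omega_2$, $(\omega_1\otimes\omega_2)(A\otimes B)=\omega_1(A)\,\omega_2(B)$, with $\omega_1,\omega_2$ states on $\mathcal B(\mathbb C^m)$ and $\mathcal B(\mathbb C^n)$. A state is separable if it is a convex combination of product states, and entangled otherwise. Let $\Phi:K_{m,n}\to K_{m,n}$ be an affine automorphism, i.e. a bijection that respects convex combinations. Then $\Phi$ takes entangled states to entangled states and separable states to separable states if and only if $\Phi$ is a composition of finitely many maps $K_{m,n}\to K_{m,n}$ of the following types: (i) conjugation by a local unitary: $\omega\mapsto \omega\big((U\otimes V)\,\cdot\,(U\otimes V)^*\big)$ with $U$, $V$ unitary operators on $\mathbb C^m$, $\mathbb C^n$; (ii) the transpose map $\omega\mapsto\omega(\,\cdot\,^{T})$, where $A^T$ is the transpose of $A$ in the standard product basis of $\mathbb C^m\otimes\mathbb C^n$;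 (iii) if $m=n$, the swap automorphism $\omega\mapsto\omega\circ\alpha$, where $\alpha$ is the $*$-automorphism of $\mathcal B(\mathbb C^m\otimes\mathbb C^m)$ with $\alpha(A\otimes B)=B\otimes A$. -/

import Mathlib

open scoped ComplexOrder Kronecker Matrix

namespace SeparableStates

/-- The operators on the Hilbert space `ℂ^ι` (finite `ι`), written as matrices in the standard
orthonormal basis. For `ι = Fin m × Fin n` this is `B(ℂ^m ⊗ ℂ^n) = B(ℂ^m) ⊗ B(ℂ^n)`, where the
operator `A ⊗ B` is the Kronecker product `A ⊗ₖ B`. -/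
abbrev Op (ι : Type) : Type := Matrix ι ι ℂ

/-- The state space: all positive linear functionals of value `1` at the identity. The order on
`ℂ` is the usual one, `0 ≤ z` meaning that `z` is real and nonnegative. -/
def stateSpace (ι : Type) [Fintype ι] [DecidableEq ι] : Set (Op ι →ₗ[ℂ] ℂ) :=
  {ω | (∀ A : Op ι, A.PosSemidef → 0 ≤ ω A) ∧ ω 1 = 1}

/-- The product states: those functionals `ω` for which there are states `ω₁` and `ω₂`
of the two factors with `ω (A ⊗ B) = ω₁ A * ω₂ B` for all `A`, `B`, that is, `ω = ω₁ ⊗ ω₂`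
(the operators `A ⊗ B` span, so `ω₁` and `ω₂` determine `ω`). -/
def productStates (m n : ℕ) : Set (Op (Fin m × Fin n) →ₗ[ℂ] ℂ) :=
  {ω | ∃ ω₁ ∈ stateSpace (Fin m), ∃ ω₂ ∈ stateSpace (Fin n),
    ∀ (A : Op (Fin m)) (B : Op (Fin n)), ω (A ⊗ₖ B) = ω₁ A * ω₂ B}

/-- The separable states: convex combinations of product states. -/
def separableStates (m n : ℕ) : Set (Op (Fin m × Fin n) →ₗ[ℂ] ℂ) :=
  convexHull ℝ (productStates m n)

/-- An affine automorphism of a set `C` (in practice convex) in a real vector space: a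
bijection of `C` onto itself that respects convex combinations. -/
def IsAffineAutomorphism {E : Type*} [AddCommGroup E] [Module ℝ E] {C : Set E}
    (Φ : C → C) : Prop :=
  Function.Bijective Φ ∧
    ∀ (x y z : C) (t : ℝ), 0 ≤ t → t ≤ 1 → (z : E) = (1 - t) • (x : E) + t • (y : E) →
      (Φ z : E) = (1 - t) • (Φ x : E) + t • (Φ y : E)

/-- `Φ` takes separable states to separable states. -/
def PreservesSeparability {m n : ℕ}
    (Φ : stateSpace (Fin m × Fin n) → stateSpace (Fin m × Fin n)) : Prop :=
  ∀ ω : stateSpace (Fin m × Fin n),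
    (ω : Op (Fin m × Fin n) →ₗ[ℂ] ℂ) ∈ separableStates m n →
      (Φ ω : Op (Fin m × Fin n) →ₗ[ℂ] ℂ) ∈ separableStates m n

/-- `Φ` takes entangled (that is, not separable) states to entangled states. -/
def PreservesEntanglement {m n : ℕ}
    (Φ : stateSpace (Fin m × Fin n) → stateSpace (Fin m × Fin n)) : Prop :=
  ∀ ω : stateSpace (Fin m × Fin n),
    (ω : Op (Fin m × Fin n) →ₗ[ℂ] ℂ) ∉ separableStates m n →
      (Φ ω : Op (Fin m × Fin n) →ₗ[ℂ] ℂ) ∉ separableStates m n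

section Duals

variable {ι : Type} [Fintype ι] [DecidableEq ι]

/-- The dual `ω ↦ ω ∘ f` of a positive unital linear map `f`, as a map on states. -/
def dualMap (f : Op ι →ₗ[ℂ] Op ι) (hf : ∀ A : Op ι, A.PosSemidef → (f A).PosSemidef)
    (h1 : f 1 = 1) (ω : stateSpace ι) : stateSpace ι :=
  ⟨(ω : Op ι →ₗ[ℂ] ℂ) ∘ₗ f,
    fun A hA => ω.2.1 (f A) (hf A hA),
    by rw [LinearMap.comp_apply, h1]; exact ω.2.2⟩

/-- The operator map `A ↦ W A W*`. -/
def conjOp (W : Op ι) : Op ι →ₗ[ℂ] Op ι where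
  toFun A := W * A * Wᴴ
  map_add' A B := by rw [mul_add, add_mul]
  map_smul' c A := by simp

/-- The operator map `A ↦ Aᵀ` (transpose in the standard basis). -/
def transposeOp (ι : Type) : Op ι →ₗ[ℂ] Op ι where
  toFun A := Aᵀ
  map_add' A B := Matrix.transpose_add A B
  map_smul' c A := Matrix.transpose_smul c A

/-- The transpose map on states. -/
def transposeMap (ι : Type) [Fintype ι] [DecidableEq ι] : stateSpace ι → stateSpace ι :=
  dualMap (transposeOp ι) (fun _ hA => hA.transpose) Matrix.transpose_one

end Duals

/-- Conjugation by the local unitary `U ⊗ V` on states: `ω ↦ ω ((U ⊗ V) · (U ⊗ V)*)`. -/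
def localConj {m n : ℕ} (U : Matrix.unitaryGroup (Fin m) ℂ) (V : Matrix.unitaryGroup (Fin n) ℂ) :
    stateSpace (Fin m × Fin n) → stateSpace (Fin m × Fin n) :=
  dualMap (conjOp ((U : Op (Fin m)) ⊗ₖ (V : Op (Fin n))))
    (fun _ hA => hA.mul_mul_conjTranspose_same _)
    (by
      have hU : (U : Op (Fin m)) * (U : Op (Fin m))ᴴ = 1 := Matrix.mem_unitaryGroup_iff.1 U.2
      have hV : (V : Op (Fin n)) * (V : Op (Fin n))ᴴ = 1 := Matrix.mem_unitaryGroup_iff.1 V.2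
      change ((U : Op (Fin m)) ⊗ₖ (V : Op (Fin n))) * 1 *
        ((U : Op (Fin m)) ⊗ₖ (V : Op (Fin n)))ᴴ = 1
      rw [mul_one, Matrix.conjTranspose_kronecker, ← Matrix.mul_kronecker_mul, hU, hV,
        Matrix.one_kronecker_one])

/-- The exchange `(i, j) ↦ (j, i)` of the two indices, for `m = n`. -/
def swapIndex {m n : ℕ} (h : m = n) (p : Fin m × Fin n) : Fin m × Fin n :=
  (Fin.cast h.symm p.2, Fin.cast h p.1)

theorem swapIndex_injective {m n : ℕ} (h : m = n) : Function.Injective (swapIndex h) := by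
  subst h
  exact Prod.swap_injective

/-- For `m = n`, the *-automorphism of `B(ℂ^m ⊗ ℂ^m)` that takes `A ⊗ B` to `B ⊗ A`. -/
def swapOp {m n : ℕ} (h : m = n) : Op (Fin m × Fin n) →ₗ[ℂ] Op (Fin m × Fin n) where
  toFun A := A.submatrix (swapIndex h) (swapIndex h)
  map_add' _ _ := rfl
  map_smul' _ _ := rfl

theorem swapOp_kronecker {m : ℕ} (A B : Op (Fin m)) :
    swapOp (rfl : m = m) (A ⊗ₖ B) = B ⊗ₖ A := by
  ext i j
  exact mul_comm _ _

/-- The swap automorphism of the state space, for `m = n`. -/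
def swapMap {m n : ℕ} (h : m = n) :
    stateSpace (Fin m × Fin n) → stateSpace (Fin m × Fin n) :=
  dualMap (swapOp h) (fun _ hA => hA.submatrix _)
    (Matrix.submatrix_one _ (swapIndex_injective h))

/-- The compositions (of any finite positive number, in any order) of conjugations by local
unitaries, the transpose map, and, if `m = n`, the swap automorphism. -/
inductive IsLocalComposition {m n : ℕ} :
    (stateSpace (Fin m × Fin n) → stateSpace (Fin m × Fin n)) → Prop
  | conj (U : Matrix.unitaryGroup (Fin m) ℂ) (V : Matrix.unitaryGroup (Fin n) ℂ) :
      IsLocalComposition (localConj U V)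
  | transpose : IsLocalComposition (transposeMap (Fin m × Fin n))
  | swap (h : m = n) : IsLocalComposition (swapMap h)
  | comp {Φ Ψ : stateSpace (Fin m × Fin n) → stateSpace (Fin m × Fin n)} :
      IsLocalComposition Φ → IsLocalComposition Ψ → IsLocalComposition (Φ ∘ Ψ)

end SeparableStates

/-! The states span all functionals, so an affine automorphism of the state space extends to a
linear bijection. On density matrices it preserves trace and adjoints, and it takes extreme states,
the rank-one projections, to extreme states. By polarisation it then takes every matrix of rank at
most one to another such matrix. Linear bijections of this kind are `ρ ↦ A ρ B` or `ρ ↦ A ρᵀ B`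
(`simple_preserver`); trace and adjoints make the conjugation unitary
(`IsAffineAutomorphism.exists_unitary`).

Up to the transpose, Φ is thus conjugation by a unitary W. A separable vector state is extreme,
hence a product state, so W takes product vectors to product vectors. With vectors of `ℂ^m ⊗ ℂ^n`
read as m × n matrices, product vectors are again the matrices of rank at most one, and
`simple_preserver` applies a second time: W is `A ⊗ B`, possibly followed by the exchange of
factors, which forces m = n.

Conversely, every generator preserves product states and has an inverse of its own type. -/

namespace SeparableStates

open Matrix

/-! ### Simple tensors and the linear bijections that preserve them -/

section RankOne

variable {ι κ ι' κ' : Type}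

/-- Matrices of rank at most one, seen as simple tensors. -/
def IsSimple (Z : Matrix ι κ ℂ) : Prop := ∃ a b, Z = vecMulVec a b

theorem IsSimple.minor {Z : Matrix ι κ ℂ} (h : IsSimple Z) (i i' : ι) (j j' : κ) :
    Z i j * Z i' j' = Z i j' * Z i' j := by
  obtain ⟨a, b, rfl⟩ := h
  simp only [vecMulVec_apply]
  ring

theorem isSimple_of_minor {Z : Matrix ι κ ℂ}
    (h : ∀ i i' j j', Z i j * Z i' j' = Z i j' * Z i' j) : IsSimple Z := by
  by_cases hZ : Z = 0
  · exact ⟨0, 0, by simp [hZ]⟩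
  · have : ∃ i j, Z i j ≠ 0 := by
      by_contra! hc
      exact hZ (by ext i j; exact hc i j)
    obtain ⟨i, j, hij⟩ := this
    refine ⟨fun k => Z k j / Z i j, fun l => Z i l, ?_⟩
    ext k l
    simp only [vecMulVec_apply]
    field_simp
    linear_combination h k i l j

theorem IsSimple.transpose {Z : Matrix ι κ ℂ} (h : IsSimple Z) : IsSimple Zᵀ := by
  obtain ⟨a, b, rfl⟩ := h
  exact ⟨b, a, transpose_vecMulVec _ _⟩

theorem transpose_eq_vecMulVec {Z : Matrix ι κ ℂ} {a : ι → ℂ} {b : κ → ℂ}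
    (h : Z = vecMulVec a b) : Zᵀ = vecMulVec b a := by
  rw [h, transpose_vecMulVec]

theorem exists_eq_smul_of_minor {p q : ι → ℂ} (hq : q ≠ 0)
    (h : ∀ i i', p i * q i' = p i' * q i) : ∃ c : ℂ, p = c • q := by
  obtain ⟨k, hk⟩ := Function.ne_iff.1 hq
  refine ⟨p k / q k, ?_⟩
  ext i
  simp only [Pi.zero_apply] at hk
  simp only [Pi.smul_apply, smul_eq_mul]
  field_simp
  linear_combination h i k

theorem ne_zero_of_vecMulVec_ne_zero {a : ι → ℂ} {b : κ → ℂ} (h : vecMulVec a b ≠ 0) : a ≠ 0 ∧ b ≠ 0 := by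
  constructor <;> rintro rfl <;> exact h (by ext; simp [vecMulVec_apply])

theorem vecMulVec_left_injective {b : κ → ℂ} (hb : b ≠ 0) {a a' : ι → ℂ}
    (h : vecMulVec a b = vecMulVec a' b) : a = a' := by
  obtain ⟨k, hk⟩ := Function.ne_iff.1 hb
  ext i
  have := congrFun (congrFun h i) k
  simp only [vecMulVec_apply] at this
  exact mul_right_cancel₀ hk this

theorem vecMulVec_right_injective {a : ι → ℂ} (ha : a ≠ 0) {b b' : κ → ℂ}
    (h : vecMulVec a b = vecMulVec a b') : b = b' := by
  obtain ⟨k, hk⟩ := Function.ne_iff.1 ha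
  ext i
  have := congrFun (congrFun h k) i
  simp only [vecMulVec_apply] at this
  exact mul_left_cancel₀ hk this

/-- The 2×2 minors of `p ⊗ q + a ⊗ b` are exactly these products. If one minor of the pair `p, a` is
nonzero, all minors of `q, b` vanish. -/
theorem parallel_of_mixed_minor {p a : ι → ℂ} {q b : κ → ℂ} (ha : a ≠ 0) (hb : b ≠ 0)
    (h : ∀ i i' j j', (p i * a i' - p i' * a i) * (q j * b j' - q j' * b j) = 0) :
    (∃ c : ℂ, p = c • a) ∨ (∃ c : ℂ, q = c • b) := by
  by_contra! hc
  obtain ⟨h1, h2⟩ := hc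
  have h1' : ∃ i i', p i * a i' - p i' * a i ≠ 0 := by
    by_contra! h
    obtain ⟨c, hc⟩ := exists_eq_smul_of_minor ha fun i i' => sub_eq_zero.1 (h i i')
    exact h1 c hc
  obtain ⟨i, i', hi⟩ := h1'
  obtain ⟨c, hc⟩ := exists_eq_smul_of_minor hb (p := q) fun j j' =>
    sub_eq_zero.1 ((mul_eq_zero.1 (h i i' j j')).resolve_left hi)
  exact h2 c hc

/-- If the sum of two simple tensors is simple, then they share a factor. -/
theorem parallel_of_isSimple_add {p a : ι → ℂ} {q b : κ → ℂ} (ha : a ≠ 0) (hb : b ≠ 0)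
    (h : IsSimple (vecMulVec p q + vecMulVec a b)) :
    (∃ c : ℂ, p = c • a) ∨ (∃ c : ℂ, q = c • b) := by
  refine parallel_of_mixed_minor ha hb fun i i' j j' => ?_
  have := h.minor i i' j j'
  simp only [Matrix.add_apply, vecMulVec_apply] at this
  linear_combination this

/-- A linear space of simple tensors shares a factor with each of its nonzero elements. -/
theorem shared_factor {V : Type*} [AddCommGroup V] [Module ℂ V] (f : V →ₗ[ℂ] Matrix ι κ ℂ)
    (hf : ∀ x, IsSimple (f x)) {x₀ : V} {a : ι → ℂ} {b : κ → ℂ} (ha : a ≠ 0) (hb : b ≠ 0)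
    (h₀ : f x₀ = vecMulVec a b) :
    (∀ x, ∃ p, f x = vecMulVec p b) ∨ (∀ x, ∃ q, f x = vecMulVec a q) := by
  have key (x : V) : (∃ p, f x = vecMulVec p b) ∨ (∃ q, f x = vecMulVec a q) := by
    obtain ⟨p, q, hpq⟩ := hf x
    have h := hf (x + x₀)
    rw [map_add, hpq, h₀] at h
    rcases parallel_of_isSimple_add ha hb h with ⟨c, rfl⟩ | ⟨c, rfl⟩
    · exact .inr ⟨c • q, by rw [hpq, smul_vecMulVec, vecMulVec_smul]⟩
    · exact .inl ⟨c • p, by rw [hpq, smul_vecMulVec, vecMulVec_smul]⟩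
  by_contra! hc
  obtain ⟨⟨x, hx⟩, ⟨y, hy⟩⟩ := hc
  obtain ⟨q, hq⟩ := (key x).resolve_left (by push Not; exact hx)
  obtain ⟨p, hp⟩ := (key y).resolve_right (by push Not; exact hy)
  -- A vector space is not the union of two proper subspaces: `x + y` would pull `x` or `y` into the
  -- wrong one.
  rcases key (x + y) with ⟨r, hr⟩ | ⟨r, hr⟩
  · apply hx (r - p)
    rw [sub_vecMulVec, ← hr, ← hp, map_add, add_sub_cancel_right]
  · apply hy (r - q)
    rw [vecMulVec_sub, ← hr, ← hq, map_add, add_sub_cancel_left]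

/-- The free factor is unique because `b ≠ 0`, so any choice of it is automatically linear. -/
theorem exists_linear_left {V : Type*} [AddCommGroup V] [Module ℂ V] (f : V →ₗ[ℂ] Matrix ι κ ℂ)
    {b : κ → ℂ} (hb : b ≠ 0) (h : ∀ x, ∃ p, f x = vecMulVec p b) :
    ∃ A : V →ₗ[ℂ] (ι → ℂ), ∀ x, f x = vecMulVec (A x) b := by
  choose A hA using h
  refine ⟨⟨⟨A, fun x y => ?_⟩, fun c x => ?_⟩, hA⟩
  · apply vecMulVec_left_injective hb
    rw [add_vecMulVec, ← hA, ← hA, ← hA, map_add]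
  · apply vecMulVec_left_injective hb
    simp only [RingHom.id_apply]
    rw [smul_vecMulVec, ← hA, ← hA, map_smul]

theorem exists_linear_right {V : Type*} [AddCommGroup V] [Module ℂ V] (f : V →ₗ[ℂ] Matrix ι κ ℂ)
    {a : ι → ℂ} (ha : a ≠ 0) (h : ∀ x, ∃ q, f x = vecMulVec a q) :
    ∃ B : V →ₗ[ℂ] (κ → ℂ), ∀ x, f x = vecMulVec a (B x) := by
  choose A hA using h
  refine ⟨⟨⟨A, fun x y => ?_⟩, fun c x => ?_⟩, hA⟩
  · apply vecMulVec_right_injective ha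
    rw [vecMulVec_add, ← hA, ← hA, ← hA, map_add]
  · apply vecMulVec_right_injective ha
    simp only [RingHom.id_apply]
    rw [vecMulVec_smul, ← hA, ← hA, map_smul]

/-- The fourth corner of a square of simple tensors with corners `a ⊗ b₀`, `a₀ ⊗ b`, `a₀ ⊗ b₀`. -/
theorem eq_vecMulVec_of_square {Z : Matrix ι κ ℂ} {a a₀ : ι → ℂ} {b b₀ : κ → ℂ}
    (ha₀ : a₀ ≠ 0) (hb₀ : b₀ ≠ 0) (ha : ∀ c : ℂ, a ≠ c • a₀) (hb : ∀ c : ℂ, b ≠ c • b₀)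
    (hZ : IsSimple Z) (h₁ : IsSimple (Z + vecMulVec a b₀)) (h₂ : IsSimple (Z + vecMulVec a₀ b))
    (h₃ : IsSimple (Z + vecMulVec a b₀ + vecMulVec a₀ b + vecMulVec a₀ b₀)) :
    Z = vecMulVec a b := by
  have ha' : a ≠ 0 := fun h => ha 0 (by simp [h])
  have hb' : b ≠ 0 := fun h => hb 0 (by simp [h])
  have e : ∃ i i', a i * a₀ i' - a i' * a₀ i ≠ 0 := by
    by_contra! h
    obtain ⟨c, hc⟩ := exists_eq_smul_of_minor ha₀ fun i i' => sub_eq_zero.1 (h i i')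
    exact ha c hc
  have e' : ∃ j j', b j * b₀ j' - b j' * b₀ j ≠ 0 := by
    by_contra! h
    obtain ⟨c, hc⟩ := exists_eq_smul_of_minor hb₀ fun i i' => sub_eq_zero.1 (h i i')
    exact hb c hc
  obtain ⟨i, i', hi⟩ := e
  obtain ⟨j, j', hj⟩ := e'
  -- Minors are quadratic forms. In this combination all polar terms cancel except that of `Z` with
  -- `a₀ ⊗ b₀` and that of `a ⊗ b₀` with `a₀ ⊗ b`, the latter nonzero for the chosen indices.
  have key : Z i j * (a₀ i' * b₀ j') + a₀ i * b₀ j * Z i' j' - Z i j' * (a₀ i' * b₀ j)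
      - a₀ i * b₀ j' * Z i' j
      = (a i * a₀ i' - a i' * a₀ i) * (b j * b₀ j' - b j' * b₀ j) := by
    have m0 := hZ.minor i i' j j'
    have m1 := h₁.minor i i' j j'
    have m2 := h₂.minor i i' j j'
    have m3 := h₃.minor i i' j j'
    simp only [Matrix.add_apply, vecMulVec_apply] at m1 m2 m3
    linear_combination m3 - m1 - m2 + m0
  have hne := mul_ne_zero hi hj
  rw [← key] at hne
  obtain ⟨p, q, rfl⟩ := hZ
  simp only [vecMulVec_apply] at key hne
  -- `Z = p ⊗ q` shares a factor with `a ⊗ b₀` and one with `a₀ ⊗ b`. Three of the four combinations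
  -- annihilate the left side of `key`; in the remaining one `key` fixes the scalar.
  rcases parallel_of_isSimple_add ha' hb₀ h₁ with ⟨c, rfl⟩ | ⟨c, rfl⟩
  · rcases parallel_of_isSimple_add ha₀ hb' h₂ with ⟨d, hd⟩ | ⟨d, rfl⟩
    · exfalso
      have hc : c = 0 := by
        by_contra hc
        apply ha (c⁻¹ * d)
        rw [mul_smul, ← hd, smul_smul, inv_mul_cancel₀ hc, one_smul]
      apply hne
      simp [hc]
    · simp only [Pi.smul_apply, smul_eq_mul] at key
      have : c * d = 1 := by
        apply mul_right_cancel₀ (mul_ne_zero hi hj)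
        linear_combination key
      rw [smul_vecMulVec, vecMulVec_smul, smul_smul, this, one_smul]
  · exfalso
    rcases parallel_of_isSimple_add ha₀ hb' h₂ with ⟨d, rfl⟩ | ⟨d, hd⟩
    · apply hne
      simp only [Pi.smul_apply, smul_eq_mul]
      ring
    · have hc : d = 0 := by
        by_contra hc
        apply hb (d⁻¹ * c)
        rw [mul_smul, hd, smul_smul, inv_mul_cancel₀ hc, one_smul]
      apply hne
      have h0 : c • b₀ = 0 := by rw [hd, hc, zero_smul]
      rw [h0]
      simp

/-- `x ↦ W (x ⊗ y)`. -/
def leftSlice (W : Matrix ι κ ℂ →ₗ[ℂ] Matrix ι' κ' ℂ) (y : κ → ℂ) :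
    (ι → ℂ) →ₗ[ℂ] Matrix ι' κ' ℂ where
  toFun x := W (vecMulVec x y)
  map_add' x x' := by rw [add_vecMulVec, map_add]
  map_smul' c x := by simp [smul_vecMulVec]

/-- `y ↦ W (x ⊗ y)`. -/
def rightSlice (W : Matrix ι κ ℂ →ₗ[ℂ] Matrix ι' κ' ℂ) (x : ι → ℂ) :
    (κ → ℂ) →ₗ[ℂ] Matrix ι' κ' ℂ where
  toFun y := W (vecMulVec x y)
  map_add' x x' := by rw [vecMulVec_add, map_add]
  map_smul' c x := by simp [vecMulVec_smul]

/-- The two slices through `(x₀, y₀)` determine everything. If `A x` is parallel to `a`, injectivity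
makes `x` parallel to `x₀`, and likewise for `y`; otherwise `eq_vecMulVec_of_square` applies. -/
theorem factor_of_straight {W : Matrix ι κ ℂ →ₗ[ℂ] Matrix ι' κ' ℂ} (hW : Function.Injective W)
    (hs : ∀ x y, IsSimple (W (vecMulVec x y))) {x₀ : ι → ℂ} {y₀ : κ → ℂ} {a : ι' → ℂ}
    {b : κ' → ℂ} (hx₀ : x₀ ≠ 0) (hy₀ : y₀ ≠ 0) (ha : a ≠ 0) (hb : b ≠ 0)
    (h₀ : W (vecMulVec x₀ y₀) = vecMulVec a b)
    (hl : ∀ x, ∃ p, W (vecMulVec x y₀) = vecMulVec p b)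
    (hr : ∀ y, ∃ q, W (vecMulVec x₀ y) = vecMulVec a q) :
    ∃ (A : (ι → ℂ) →ₗ[ℂ] (ι' → ℂ)) (B : (κ → ℂ) →ₗ[ℂ] (κ' → ℂ)),
      ∀ x y, W (vecMulVec x y) = vecMulVec (A x) (B y) := by
  obtain ⟨A, hA⟩ := exists_linear_left (leftSlice W y₀) hb hl
  obtain ⟨B, hB⟩ := exists_linear_right (rightSlice W x₀) ha hr
  replace hA : ∀ x, W (vecMulVec x y₀) = vecMulVec (A x) b := hA
  replace hB : ∀ y, W (vecMulVec x₀ y) = vecMulVec a (B y) := hB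
  have hA₀ : A x₀ = a := vecMulVec_left_injective hb (by rw [← hA, h₀])
  have hB₀ : B y₀ = b := vecMulVec_right_injective ha (by rw [← hB, h₀])
  refine ⟨A, B, fun x y => ?_⟩
  by_cases hx : ∃ c : ℂ, A x = c • a
  · obtain ⟨c, hc⟩ := hx
    have : x = c • x₀ := by
      apply vecMulVec_left_injective hy₀
      apply hW
      rw [hA, hA, map_smul, hA₀, hc]
    rw [hc, this, smul_vecMulVec, map_smul, hB, smul_vecMulVec]
  by_cases hy : ∃ c : ℂ, B y = c • b
  · obtain ⟨c, hc⟩ := hy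
    have : y = c • y₀ := by
      apply vecMulVec_right_injective hx₀
      apply hW
      rw [hB, hB, map_smul, hB₀, hc]
    rw [hc, this, vecMulVec_smul, map_smul, hA, vecMulVec_smul]
  push Not at hx hy
  refine eq_vecMulVec_of_square ha hb hx hy (hs x y) ?_ ?_ ?_
  · rw [← hA, ← map_add, ← vecMulVec_add]
    exact hs _ _
  · rw [← hB, ← map_add, ← add_vecMulVec]
    exact hs _ _
  · have := hs (x + x₀) (y + y₀)
    rw [vecMulVec_add, add_vecMulVec, add_vecMulVec, map_add, map_add, map_add, hA, hB, h₀] at this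
    convert this using 1
    abel

theorem mem_of_vecMulVec_mem [Fintype ι] [Fintype κ] [DecidableEq ι] [DecidableEq κ]
    {S : Submodule ℂ (Matrix ι κ ℂ)} (h : ∀ x y, vecMulVec x y ∈ S) (X : Matrix ι κ ℂ) :
    X ∈ S := by
  rw [matrix_eq_sum_single X]
  refine S.sum_mem fun i _ => S.sum_mem fun j _ => ?_
  have := S.smul_mem (X i j) (h (Pi.single i 1) (Pi.single j 1))
  rwa [← single_eq_single_vecMulVec_single, smul_single, smul_eq_mul, mul_one] at this

theorem linearMap_ext_vecMulVec [Fintype ι] [Fintype κ] [DecidableEq ι] [DecidableEq κ]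
    {V : Type*} [AddCommGroup V] [Module ℂ V] {f g : Matrix ι κ ℂ →ₗ[ℂ] V}
    (h : ∀ x y, f (vecMulVec x y) = g (vecMulVec x y)) : f = g := by
  ext1 X
  exact mem_of_vecMulVec_mem (S := LinearMap.eqLocus f g) h X

/-- Excludes the degenerate configuration of `simple_preserver`. If both slices keep the same right
factor `b`, comparison of minors spreads it to the whole image, and surjectivity leaves room for
only one coordinate. -/
theorem subsingleton_of_common_right [Fintype ι] [Fintype κ] [DecidableEq ι] [DecidableEq κ]
    [Nonempty ι'] [DecidableEq κ']
    {W : Matrix ι κ ℂ →ₗ[ℂ] Matrix ι' κ' ℂ} (hW : Function.Bijective W)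
    (hs : ∀ x y, IsSimple (W (vecMulVec x y))) {x₀ : ι → ℂ} {y₀ : κ → ℂ} {a : ι' → ℂ}
    {b : κ' → ℂ} (hy₀ : y₀ ≠ 0) (ha : a ≠ 0) (hb : b ≠ 0)
    (h₀ : W (vecMulVec x₀ y₀) = vecMulVec a b)
    (hl : ∀ x, ∃ p, W (vecMulVec x y₀) = vecMulVec p b)
    (hr : ∀ y, ∃ p, W (vecMulVec x₀ y) = vecMulVec p b) : Subsingleton κ' := by
  have key (x y) : ∃ p, W (vecMulVec x y) = vecMulVec p b := by
    obtain ⟨p, hp⟩ := hl x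
    obtain ⟨p', hp'⟩ := hr y
    by_cases hx : ∃ c : ℂ, p = c • a
    · obtain ⟨c, hc⟩ := hx
      have : x = c • x₀ := by
        apply vecMulVec_left_injective hy₀
        apply hW.1
        rw [hp, smul_vecMulVec, map_smul, h₀, hc, smul_vecMulVec]
      exact ⟨c • p', by rw [this, smul_vecMulVec, map_smul, hp', smul_vecMulVec]⟩
    have hp0 : p ≠ 0 := fun h => hx ⟨0, by simp [h]⟩
    have h1 : IsSimple (W (vecMulVec x y) + vecMulVec p b) := by
      rw [← hp, ← map_add, ← vecMulVec_add]
      exact hs _ _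
    have h2 : IsSimple (W (vecMulVec x y) + vecMulVec p' b) := by
      rw [← hp', ← map_add, ← add_vecMulVec]
      exact hs _ _
    have h3 : IsSimple (W (vecMulVec x y) + vecMulVec p b + vecMulVec p' b + vecMulVec a b) := by
      have := hs (x + x₀) (y + y₀)
      rw [vecMulVec_add, add_vecMulVec, add_vecMulVec, map_add, map_add, map_add, hp, hp', h₀]
        at this
      convert this using 1
      abel
    have h4 := hs x y
    obtain ⟨r, s, hrs⟩ := hs x y
    rw [hrs] at h1 h2 h3 h4 ⊢
    rcases parallel_of_isSimple_add hp0 hb h1 with ⟨c, rfl⟩ | ⟨c, rfl⟩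
    · have : (∃ d : ℂ, c • p = d • a) ∨ ∃ d : ℂ, s = d • b := by
        refine parallel_of_mixed_minor ha hb fun i i' j j' => ?_
        have m1 := h1.minor i i' j j'
        have m2 := h2.minor i i' j j'
        have m3 := h3.minor i i' j j'
        have m4 := h4.minor i i' j j'
        simp only [Matrix.add_apply, vecMulVec_apply] at m1 m2 m3 m4
        linear_combination m3 - m1 - m2 + m4
      rcases this with ⟨d, hd⟩ | ⟨d, rfl⟩
      · have hc : c = 0 := by
          by_contra hc
          apply hx
          exact ⟨c⁻¹ * d, by rw [mul_smul, ← hd, smul_smul, inv_mul_cancel₀ hc, one_smul]⟩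
        exact ⟨0, by simp [hc]⟩
      · exact ⟨d • c • p, by rw [vecMulVec_smul, smul_vecMulVec d]⟩
    · exact ⟨c • r, by rw [vecMulVec_smul, smul_vecMulVec]⟩
  have all (X : Matrix ι κ ℂ) : ∃ p, W X = vecMulVec p b := by
    let T : (ι' → ℂ) →ₗ[ℂ] Matrix ι' κ' ℂ :=
      { toFun := fun p => vecMulVec p b
        map_add' := fun p q => add_vecMulVec _ _ _
        map_smul' := fun c p => smul_vecMulVec _ _ _ }
    have := mem_of_vecMulVec_mem (S := (LinearMap.range T).comap W) (fun x y => by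
      obtain ⟨p, hp⟩ := key x y
      exact ⟨p, hp.symm⟩) X
    obtain ⟨p, hp⟩ := this
    exact ⟨p, hp.symm⟩
  refine ⟨fun j j' => ?_⟩
  by_contra hj
  have par (q : κ' → ℂ) (hq : q ≠ 0) : ∃ c : ℂ, b = c • q := by
    obtain ⟨X, hX⟩ := hW.2 (vecMulVec (fun _ => 1) q)
    obtain ⟨p, hp⟩ := all X
    obtain ⟨i⟩ := ‹Nonempty ι'›
    have e (j) : q j = p i * b j := by
      have := congrFun (congrFun (hX.symm.trans hp) i) j
      simpa [vecMulVec_apply] using this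
    have hpi : p i ≠ 0 := fun h => hq (by ext j; simp [e, h])
    refine ⟨(p i)⁻¹, ?_⟩
    ext j
    simp only [Pi.smul_apply, smul_eq_mul, e]
    field_simp
  obtain ⟨c, hc⟩ := par (Pi.single j 1) (by simp)
  obtain ⟨d, hd⟩ := par (Pi.single j' 1) (by simp)
  apply hb
  ext k
  by_cases hk : k = j
  · rw [hd]
    subst hk
    simp [hj]
  · rw [hc]
    simp [hk]

theorem eq_smul_of_subsingleton [Subsingleton ι] {x₀ : ι → ℂ} (hx₀ : x₀ ≠ 0) (x : ι → ℂ) :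
    ∃ c : ℂ, x = c • x₀ :=
  exists_eq_smul_of_minor hx₀ fun i i' => by rw [Subsingleton.elim i i']

/-- Linear bijections of `ℂ^ι ⊗ ℂ^κ` that preserve simple tensors are local, up to a swap. -/
theorem simple_preserver [Fintype ι] [Fintype κ] [DecidableEq ι] [DecidableEq κ]
    [Nonempty ι] [Nonempty κ] {W : Matrix ι κ ℂ →ₗ[ℂ] Matrix ι κ ℂ} (hW : Function.Bijective W)
    (hs : ∀ x y, IsSimple (W (vecMulVec x y))) :
    (∃ (A : (ι → ℂ) →ₗ[ℂ] (ι → ℂ)) (B : (κ → ℂ) →ₗ[ℂ] (κ → ℂ)),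
      ∀ x y, W (vecMulVec x y) = vecMulVec (A x) (B y)) ∨
    (∃ (A : (ι → ℂ) →ₗ[ℂ] (κ → ℂ)) (B : (κ → ℂ) →ₗ[ℂ] (ι → ℂ)),
      ∀ x y, W (vecMulVec x y) = vecMulVec (B y) (A x)) := by
  have hx₀ : (1 : ι → ℂ) ≠ 0 := one_ne_zero
  have hy₀ : (1 : κ → ℂ) ≠ 0 := one_ne_zero
  obtain ⟨a, b, h₀⟩ := hs 1 1
  have hne : vecMulVec a b ≠ 0 := by
    rw [← h₀]
    intro h
    have := hW.1 (h.trans (map_zero W).symm)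
    obtain ⟨i⟩ := ‹Nonempty ι›
    obtain ⟨j⟩ := ‹Nonempty κ›
    simpa [vecMulVec_apply] using congrFun (congrFun this i) j
  obtain ⟨ha, hb⟩ := ne_zero_of_vecMulVec_ne_zero hne
  let τ : Matrix ι κ ℂ ≃ₗ[ℂ] Matrix κ ι ℂ := transposeLinearEquiv ι κ ℂ ℂ
  let W' : Matrix ι κ ℂ →ₗ[ℂ] Matrix κ ι ℂ := τ.toLinearMap ∘ₗ W
  have hW'a (X) : W' X = (W X)ᵀ := rfl
  have hW' : Function.Bijective W' := τ.bijective.comp hW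
  have hs' (x y) : IsSimple (W' (vecMulVec x y)) := (hs x y).transpose
  have h₀' : W' (vecMulVec 1 1) = vecMulVec b a := by rw [hW'a, h₀, transpose_vecMulVec]
  have straight (hl : ∀ x, ∃ p, W (vecMulVec x 1) = vecMulVec p b)
      (hr : ∀ y, ∃ q, W (vecMulVec 1 y) = vecMulVec a q) :=
    factor_of_straight hW.1 hs hx₀ hy₀ ha hb h₀ hl hr
  -- Each slice fixes one factor of `a ⊗ b`. Different sides give the straight or the swapped form;
  -- the same side forces a one-element index type, where the straight form holds trivially.
  rcases shared_factor (leftSlice W 1) (fun x => hs x 1) ha hb h₀ with hl | hl <;>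
  rcases shared_factor (rightSlice W 1) (fun y => hs 1 y) ha hb h₀ with hr | hr
  · left
    have := subsingleton_of_common_right hW hs hy₀ ha hb h₀ hl hr
    refine straight hl fun y => ?_
    obtain ⟨c, rfl⟩ := eq_smul_of_subsingleton hy₀ y
    exact ⟨c • b, by rw [vecMulVec_smul, map_smul, h₀, vecMulVec_smul]⟩
  · exact .inl (straight hl hr)
  · right
    obtain ⟨A, B, h⟩ := factor_of_straight hW'.1 hs' hx₀ hy₀ hb ha h₀'
      (fun x => (hl x).imp fun _ hq => transpose_eq_vecMulVec hq)
      (fun y => (hr y).imp fun _ hq => transpose_eq_vecMulVec hq)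
    refine ⟨A, B, fun x y => ?_⟩
    rw [← transpose_eq_vecMulVec (h x y), hW'a, transpose_transpose]
  · left
    have := subsingleton_of_common_right hW' hs' hy₀ hb ha h₀'
      (fun x => (hl x).imp fun _ hq => transpose_eq_vecMulVec hq)
      (fun y => (hr y).imp fun _ hq => transpose_eq_vecMulVec hq)
    refine straight (fun x => ?_) hr
    obtain ⟨c, rfl⟩ := eq_smul_of_subsingleton hx₀ x
    exact ⟨c • a, by rw [smul_vecMulVec, map_smul, h₀, smul_vecMulVec]⟩

end RankOne

/-! ### Density matrices and extreme states -/

section Density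

variable {ι : Type} [Fintype ι] [DecidableEq ι]

theorem mem_of_vecMulVec_star_mem {S : Submodule ℂ (Op ι)}
    (h : ∀ x, vecMulVec x (star x) ∈ S) (A : Op ι) : A ∈ S := by
  refine mem_of_vecMulVec_mem (fun x y => ?_) A
  -- Polarisation in `x` and `star y`, as `vecMulVec` does not conjugate its second argument.
  have key : vecMulVec x y = (4 : ℂ)⁻¹ •
      (vecMulVec (x + star y) (star (x + star y))
        - vecMulVec (x + (-1 : ℂ) • star y) (star (x + (-1 : ℂ) • star y))
        + Complex.I • vecMulVec (x + Complex.I • star y) (star (x + Complex.I • star y))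
        - Complex.I • vecMulVec (x + (-Complex.I) • star y)
          (star (x + (-Complex.I) • star y))) := by
    ext i j
    simp only [vecMulVec_apply, Matrix.smul_apply, Matrix.add_apply, Matrix.sub_apply,
      Pi.star_apply, Pi.add_apply, Pi.smul_apply, smul_eq_mul, star_add, star_mul', star_star,
      star_neg, star_one, Complex.star_def, Complex.conj_I, Complex.conj_conj]
    linear_combination ((1 : ℂ) / 2 * (x i * y j) -
      1 / 2 * (starRingEnd ℂ (y i) * starRingEnd ℂ (x j))) * Complex.I_mul_I
  rw [key]
  exact S.smul_mem _ (S.sub_mem (S.add_mem (S.sub_mem (h _) (h _)) (S.smul_mem _ (h _)))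
    (S.smul_mem _ (h _)))

theorem linearMap_ext_vecMulVec_star {V : Type*} [AddCommGroup V] [Module ℂ V]
    {f g : Op ι →ₗ[ℂ] V} (h : ∀ x, f (vecMulVec x (star x)) = g (vecMulVec x (star x))) :
    f = g := by
  ext1 A
  exact mem_of_vecMulVec_star_mem (S := LinearMap.eqLocus f g) h A

/-- The functional `A ↦ tr (ρ A)` of a matrix `ρ`. -/
def traceFunctional : Op ι →ₗ[ℂ] Op ι →ₗ[ℂ] ℂ :=
  (LinearMap.mul ℂ (Op ι)).compr₂ (traceLinearMap ι ℂ ℂ)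

@[simp]
theorem traceFunctional_apply (ρ A : Op ι) : traceFunctional ρ A = trace (ρ * A) := rfl

theorem traceFunctional_bijective : Function.Bijective (traceFunctional (ι := ι)) := by
  constructor
  · intro ρ σ h
    exact ext_iff_trace_mul_right.2 fun A => LinearMap.congr_fun h A
  · intro ω
    refine ⟨of fun i j => ω (single j i 1), ?_⟩
    apply Matrix.ext_linearMap
    intro i j
    ext1
    simp [trace_mul_single]

/-- The density matrix of a functional. -/
noncomputable def density : (Op ι →ₗ[ℂ] ℂ) ≃ₗ[ℂ] Op ι :=
  (LinearEquiv.ofBijective traceFunctional traceFunctional_bijective).symm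

theorem trace_density_mul (ω : Op ι →ₗ[ℂ] ℂ) (A : Op ι) : trace (density ω * A) = ω A :=
  LinearMap.congr_fun ((LinearEquiv.ofBijective traceFunctional
    traceFunctional_bijective).apply_symm_apply ω) A

theorem density_traceFunctional (ρ : Op ι) : density (traceFunctional ρ) = ρ :=
  (LinearEquiv.ofBijective traceFunctional traceFunctional_bijective).symm_apply_apply ρ

theorem density_real_smul (a : ℝ) (ω : Op ι →ₗ[ℂ] ℂ) :
    density (a • ω) = (a : ℂ) • density ω := by
  rw [← map_smul]
  rfl

omit [DecidableEq ι] in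
theorem trace_mul_vecMulVec_star (M : Op ι) (x : ι → ℂ) :
    trace (M * vecMulVec x (star x)) = star x ⬝ᵥ (M *ᵥ x) := by
  rw [mul_vecMulVec, trace_vecMulVec, dotProduct_comm]

/-- Positivity makes `ω` real on the matrices `x x*`, and these span. -/
theorem apply_conjTranspose_of_nonneg {ω : Op ι →ₗ[ℂ] ℂ}
    (h : ∀ A : Op ι, A.PosSemidef → 0 ≤ ω A) (A : Op ι) : ω Aᴴ = star (ω A) := by
  let f : Op ι →ₗ[ℂ] ℂ :=
    { toFun := fun A => star (ω Aᴴ)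
      map_add' := fun A B => by simp
      map_smul' := fun c A => by simp }
  have : f = ω := by
    refine linearMap_ext_vecMulVec_star fun x => ?_
    have hx := posSemidef_vecMulVec_self_star x
    have := (IsSelfAdjoint.of_nonneg (h _ hx)).star_eq
    change star (ω _) = _
    rw [hx.isHermitian.eq, this]
  have h := LinearMap.congr_fun this A
  rw [← h]
  exact (star_star _).symm

omit [DecidableEq ι] in
theorem trace_mul_nonneg {A B : Op ι} (hA : A.PosSemidef) (hB : B.PosSemidef) :
    0 ≤ trace (A * B) := by
  obtain ⟨m, v, rfl⟩ := posSemidef_iff_eq_sum_vecMulVec.1 hB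
  rw [Finset.mul_sum, trace_sum]
  refine Finset.sum_nonneg fun i _ => ?_
  rw [trace_mul_vecMulVec_star]
  exact hA.dotProduct_mulVec_nonneg _

theorem mem_stateSpace_iff {ω : Op ι →ₗ[ℂ] ℂ} :
    ω ∈ stateSpace ι ↔ (density ω).PosSemidef ∧ trace (density ω) = 1 := by
  have h1 : trace (density ω) = ω 1 := by rw [← trace_density_mul, mul_one]
  rw [h1]
  refine and_congr_left' ⟨fun h => ?_, fun h A hA => ?_⟩
  · refine PosSemidef.of_dotProduct_mulVec_nonneg ?_ fun x => ?_
    · apply ext_iff_trace_mul_right.2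
      intro A
      have := apply_conjTranspose_of_nonneg h Aᴴ
      rw [conjTranspose_conjTranspose] at this
      rw [trace_density_mul, this, ← trace_density_mul, ← trace_conjTranspose,
        conjTranspose_mul, conjTranspose_conjTranspose, trace_mul_comm]
    · rw [← trace_mul_vecMulVec_star, trace_density_mul]
      exact h _ (posSemidef_vecMulVec_self_star x)
  · rw [← trace_density_mul]
    exact trace_mul_nonneg h hA

theorem traceFunctional_mem_stateSpace {ρ : Op ι} (h : ρ.PosSemidef) (h1 : trace ρ = 1) :
    traceFunctional ρ ∈ stateSpace ι := by
  rw [mem_stateSpace_iff, density_traceFunctional]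
  exact ⟨h, h1⟩

theorem convex_stateSpace : Convex ℝ (stateSpace ι) := by
  intro ω hω τ hτ a b ha hb hab
  refine ⟨fun A hA => ?_, ?_⟩
  · have h1 : (0 : ℂ) ≤ a := by exact_mod_cast ha
    have h2 : (0 : ℂ) ≤ b := by exact_mod_cast hb
    exact add_nonneg (mul_nonneg h1 (hω.1 A hA)) (mul_nonneg h2 (hτ.1 A hA))
  · change (a : ℂ) * ω 1 + (b : ℂ) * τ 1 = 1
    rw [hω.2, hτ.2]
    simpa using congrArg (Complex.ofReal) hab

omit [DecidableEq ι] in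
theorem dotProduct_star_self_ofReal (x : ι → ℂ) : ∃ t : ℝ, 0 ≤ t ∧ x ⬝ᵥ star x = t ∧
    (t = 0 → x = 0) := by
  have h := dotProduct_star_self_nonneg x
  rw [dotProduct_comm, Complex.nonneg_iff] at h
  have e : x ⬝ᵥ star x = ((x ⬝ᵥ star x).re : ℂ) := Complex.ext rfl (by simp [← h.2])
  refine ⟨_, h.1, e, fun h0 => ?_⟩
  rw [h0] at e
  exact dotProduct_star_self_eq_zero.1 (by simpa using e)

omit [DecidableEq ι] in
theorem exists_normalized (x : ι → ℂ) (hx : x ≠ 0) :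
    ∃ t : ℝ, 0 < t ∧ x ⬝ᵥ star x = t ∧ ∃ y : ι → ℂ, y ⬝ᵥ star y = 1 ∧
      (∃ c : ℂ, x = c • y) ∧ vecMulVec y (star y) = (t : ℂ)⁻¹ • vecMulVec x (star x) := by
  obtain ⟨t, ht, e, h0⟩ := dotProduct_star_self_ofReal x
  have ht' : 0 < t := lt_of_le_of_ne ht fun h => hx (h0 h.symm)
  have hs : Real.sqrt t ≠ 0 := (Real.sqrt_pos.2 ht').ne'
  have hs' : (Real.sqrt t : ℂ) ≠ 0 := by exact_mod_cast hs
  have hss : (Real.sqrt t : ℂ) * Real.sqrt t = t := by exact_mod_cast Real.mul_self_sqrt ht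
  have key : vecMulVec ((Real.sqrt t : ℂ)⁻¹ • x) (star ((Real.sqrt t : ℂ)⁻¹ • x)) =
      (t : ℂ)⁻¹ • vecMulVec x (star x) := by
    rw [star_smul, smul_vecMulVec, vecMulVec_smul, smul_smul]
    congr 1
    rw [← hss, mul_inv]
    congr 1
    simp
  refine ⟨t, ht', e, (Real.sqrt t : ℂ)⁻¹ • x, ?_, ⟨Real.sqrt t, ?_⟩, key⟩
  · have ht2 : (t : ℂ) ≠ 0 := by exact_mod_cast ht'.ne'
    rw [← trace_vecMulVec, key, trace_smul, trace_vecMulVec, e, smul_eq_mul,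
      inv_mul_cancel₀ ht2]
  · rw [smul_smul, mul_inv_cancel₀ hs', one_smul]

/-- Vector states are extreme. -/
theorem mem_extremePoints_of_density {ω : Op ι →ₗ[ℂ] ℂ} (hω : ω ∈ stateSpace ι) {x : ι → ℂ}
    (hx : density ω = vecMulVec x (star x)) : ω ∈ (stateSpace ι).extremePoints ℝ := by
  rw [mem_extremePoints_iff_left]
  refine ⟨hω, fun ω₁ h₁ ω₂ h₂ hs => ?_⟩
  obtain ⟨a, b, ha, hb, hab, h⟩ := hs
  have hM := congrArg density h
  rw [map_add, density_real_smul, density_real_smul, hx] at hM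
  obtain ⟨p₁, t₁⟩ := mem_stateSpace_iff.1 h₁
  obtain ⟨p₂, t₂⟩ := mem_stateSpace_iff.1 h₂
  have hn : star x ⬝ᵥ x = 1 := by
    have := (mem_stateSpace_iff.1 hω).2
    rwa [hx, trace_vecMulVec, dotProduct_comm] at this
  apply density.injective
  rw [hx]
  set M := density ω₁
  have ha' : (0 : ℂ) < a := by exact_mod_cast ha
  have hb' : (0 : ℂ) < b := by exact_mod_cast hb
  -- On the complement of `x` the two nonnegative quadratic forms sum to zero, so `M` vanishes
  -- there. Self-adjointness and trace one then leave only `x x*`.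
  have ker (v : ι → ℂ) (hv : star x ⬝ᵥ v = 0) : M *ᵥ v = 0 := by
    rw [← p₁.dotProduct_mulVec_zero_iff]
    have e := congrArg (fun N => star v ⬝ᵥ (N *ᵥ v)) hM
    simp only [add_mulVec, smul_mulVec, dotProduct_add, dotProduct_smul, vecMulVec_mulVec, hv,
      MulOpposite.op_zero, zero_smul, dotProduct_zero, smul_eq_mul] at e
    have n1 := p₁.dotProduct_mulVec_nonneg v
    have n2 := p₂.dotProduct_mulVec_nonneg v
    have := (add_eq_zero_iff_of_nonneg (mul_nonneg ha'.le n1) (mul_nonneg hb'.le n2)).1 e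
    exact (mul_eq_zero.1 this.1).resolve_left ha'.ne'
  have hMP : M = vecMulVec (M *ᵥ x) (star x) := by
    apply ext_of_mulVec_single
    intro i
    have := ker (Pi.single i 1 - (star x ⬝ᵥ Pi.single i 1) • x) (by
      rw [dotProduct_sub, dotProduct_smul, hn, smul_eq_mul, mul_one, sub_self])
    rw [mulVec_sub, mulVec_smul, sub_eq_zero] at this
    rw [this, vecMulVec_mulVec, op_smul_eq_smul]
  have hMx : M *ᵥ x = (star (M *ᵥ x) ⬝ᵥ x) • x := by
    have := congrArg conjTranspose hMP
    rw [p₁.isHermitian.eq, conjTranspose_vecMulVec, star_star] at this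
    conv_lhs => rw [this]
    rw [vecMulVec_mulVec, op_smul_eq_smul]
  rw [hMx, smul_vecMulVec] at hMP
  have ht := congrArg trace hMP
  rw [t₁, trace_smul, trace_vecMulVec, dotProduct_comm x, hn, smul_eq_mul, mul_one] at ht
  rw [hMP, ← ht, one_smul]

/-- Extreme states are vector states. -/
theorem exists_density_of_mem_extremePoints {ω : Op ι →ₗ[ℂ] ℂ}
    (hω : ω ∈ (stateSpace ι).extremePoints ℝ) : ∃ x, density ω = vecMulVec x (star x) := by
  rw [mem_extremePoints_iff_left] at hω
  obtain ⟨hs, hext⟩ := hω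
  obtain ⟨hp, ht⟩ := mem_stateSpace_iff.1 hs
  obtain ⟨m, v, hv⟩ := posSemidef_iff_eq_sum_vecMulVec.1 hp
  have : ∃ k, v k ≠ 0 := by
    by_contra! h
    rw [hv] at ht
    simp [h] at ht
  obtain ⟨k, hk⟩ := this
  -- Splitting off `v k` gives weight `t = ‖v k‖²` and remainder `R` of trace `1 - t`. Either `R =
  -- 0`, or normalising both parts yields a proper convex decomposition, to which extremality
  -- applies.
  set R : Op ι := ∑ i ∈ Finset.univ.erase k, vecMulVec (v i) (star (v i))
  have hR : R.PosSemidef := posSemidef_sum _ fun i _ => posSemidef_vecMulVec_self_star _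
  have hsum : density ω = vecMulVec (v k) (star (v k)) + R := by
    rw [hv]
    exact (Finset.add_sum_erase _ (fun i => vecMulVec (v i) (star (v i)))
      (Finset.mem_univ k)).symm
  obtain ⟨t, t0, htk, y, hy, -, hyk⟩ := exists_normalized (v k) hk
  have htr : (t : ℂ) + trace R = 1 := by rw [← ht, hsum, trace_add, trace_vecMulVec, htk]
  have ht0 : (t : ℂ) ≠ 0 := by exact_mod_cast t0.ne'
  have hR0 := hR.trace_nonneg
  rw [show trace R = ((1 - t : ℝ) : ℂ) by push_cast; linear_combination htr] at hR0
  have t1 : 0 ≤ 1 - t := by exact_mod_cast hR0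
  rcases t1.eq_or_lt with h1 | h1
  · refine ⟨v k, ?_⟩
    rw [hsum, hR.trace_eq_zero_iff.1, add_zero]
    rw [show trace R = ((1 - t : ℝ) : ℂ) by push_cast; linear_combination htr, ← h1]
    simp
  · refine ⟨y, ?_⟩
    have h1' : ((1 - t : ℝ) : ℂ) ≠ 0 := by exact_mod_cast h1.ne'
    have s1 : traceFunctional (vecMulVec y (star y)) ∈ stateSpace ι :=
      traceFunctional_mem_stateSpace (posSemidef_vecMulVec_self_star _)
        (by rw [trace_vecMulVec, hy])
    have s2 : traceFunctional (((1 - t : ℝ) : ℂ)⁻¹ • R) ∈ stateSpace ι := by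
      apply traceFunctional_mem_stateSpace
      · apply hR.smul
        rw [← Complex.ofReal_inv]
        exact_mod_cast (inv_pos.2 h1).le
      · rw [trace_smul, smul_eq_mul, show trace R = ((1 - t : ℝ) : ℂ) by
          push_cast; linear_combination htr, inv_mul_cancel₀ h1']
    have := hext _ s1 _ s2 ⟨t, 1 - t, t0, h1, by ring, ?_⟩
    · rw [← this, density_traceFunctional]
    · apply density.injective
      rw [map_add, density_real_smul, density_real_smul, density_traceFunctional,
        density_traceFunctional, hyk, smul_smul, smul_smul, mul_inv_cancel₀ ht0,
        mul_inv_cancel₀ h1', one_smul, one_smul, hsum]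

end Density

/-! ### Linear extension of affine automorphisms -/

section Automorphism

theorem IsAffineAutomorphism.mem_extremePoints {E : Type*} [AddCommGroup E] [Module ℝ E]
    {C : Set E} {Φ : C → C} (hΦ : IsAffineAutomorphism Φ) (hC : Convex ℝ C) {x : C}
    (hx : (x : E) ∈ C.extremePoints ℝ) : (Φ x : E) ∈ C.extremePoints ℝ := by
  rw [mem_extremePoints_iff_left] at hx ⊢
  refine ⟨(Φ x).2, fun y' hy' z' hz' h => ?_⟩
  obtain ⟨⟨y, hy⟩, hyy⟩ := hΦ.1.2 ⟨y', hy'⟩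
  obtain ⟨⟨z, hz⟩, hzz⟩ := hΦ.1.2 ⟨z', hz'⟩
  obtain ⟨a, b, ha, hb, hab, h⟩ := h
  obtain rfl : a = 1 - b := by linarith
  have hw := hC hy hz ha.le hb.le hab
  have e := hΦ.2 ⟨y, hy⟩ ⟨z, hz⟩ ⟨_, hw⟩ b hb.le (by linarith) rfl
  rw [hyy, hzz] at e
  have e2 : (⟨_, hw⟩ : C) = x := hΦ.1.1 (Subtype.ext (e.trans h))
  have := hx.2 y hy z hz ⟨1 - b, b, ha, hb, hab, congrArg Subtype.val e2⟩
  rw [show y' = ((⟨y', hy'⟩ : C) : E) from rfl, ← hyy]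
  congr 2
  exact Subtype.ext this

/-- Convexity of the graph passes from two-point to finite convex combinations through
`Convex.sum_mem`. -/
theorem IsAffineAutomorphism.convex_graph {E : Type*} [AddCommGroup E] [Module ℝ E]
    {C : Set E} {Φ : C → C} (hΦ : IsAffineAutomorphism Φ) (hC : Convex ℝ C) :
    Convex ℝ (Set.range fun x : C => ((x : E), (Φ x : E))) := by
  rintro _ ⟨x, rfl⟩ _ ⟨y, rfl⟩ a b ha hb hab
  obtain rfl : a = 1 - b := by linarith
  have hw := hC x.2 y.2 ha hb hab
  exact ⟨⟨_, hw⟩, Prod.ext rfl (hΦ.2 x y ⟨_, hw⟩ b hb (by linarith) rfl)⟩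

theorem IsAffineAutomorphism.sum_eq {E : Type*} [AddCommGroup E] [Module ℝ E]
    {C : Set E} {Φ : C → C} (hΦ : IsAffineAutomorphism Φ) (hC : Convex ℝ C)
    {s : Finset C} {w w' : C → ℝ} (hw : ∀ x ∈ s, 0 ≤ w x) (hw' : ∀ x ∈ s, 0 ≤ w' x) {r : ℝ}
    (hr : ∑ x ∈ s, w x = r) (hr' : ∑ x ∈ s, w' x = r)
    (h : ∑ x ∈ s, w x • (x : E) = ∑ x ∈ s, w' x • (x : E)) :
    ∑ x ∈ s, w x • (Φ x : E) = ∑ x ∈ s, w' x • (Φ x : E) := by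
  by_cases h0 : r = 0
  · rw [h0] at hr hr'
    rw [Finset.sum_eq_zero_iff_of_nonneg hw] at hr
    rw [Finset.sum_eq_zero_iff_of_nonneg hw'] at hr'
    exact Finset.sum_congr rfl fun x hx => by rw [hr x hx, hr' x hx]
  have hrpos : 0 ≤ r := hr ▸ Finset.sum_nonneg hw
  have mem {w : C → ℝ} (hw : ∀ x ∈ s, 0 ≤ w x) (hr : ∑ x ∈ s, w x = r) :
      ∃ z : C, ∑ x ∈ s, (r⁻¹ * w x) • (x : E) = z ∧ ∑ x ∈ s, (r⁻¹ * w x) • (Φ x : E) = Φ z := by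
    have := (hΦ.convex_graph hC).sum_mem (t := s) (w := fun x => r⁻¹ * w x)
      (z := fun x => ((x : E), (Φ x : E))) (fun x hx => mul_nonneg (inv_nonneg.2 hrpos) (hw x hx))
      (by rw [← Finset.mul_sum, hr, inv_mul_cancel₀ h0]) (fun x _ => ⟨x, rfl⟩)
    obtain ⟨z, hz⟩ := this
    refine ⟨z, ?_, ?_⟩
    · have := congrArg Prod.fst hz
      simpa [Prod.fst_sum] using this.symm
    · have := congrArg Prod.snd hz
      simpa [Prod.snd_sum] using this.symm
  obtain ⟨z, hz, hΦz⟩ := mem hw hr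
  obtain ⟨z', hz', hΦz'⟩ := mem hw' hr'
  simp only [mul_smul, ← Finset.smul_sum] at hz hz' hΦz hΦz'
  have : z = z' := Subtype.ext (by rw [← hz, ← hz', h])
  rw [this, ← hΦz'] at hΦz
  exact smul_right_injective E (inv_ne_zero h0) hΦz

variable {ι : Type} [Fintype ι] [DecidableEq ι]

theorem state_apply_ofReal (ω : stateSpace ι) {A : Op ι} (hA : A.PosSemidef) :
    (((ω : Op ι →ₗ[ℂ] ℂ) A).re : ℂ) = (ω : Op ι →ₗ[ℂ] ℂ) A :=
  Complex.ext rfl (by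
    have := (Complex.nonneg_iff.1 (ω.2.1 A hA)).2
    simp [← this])

theorem sum_real_smul_state_apply (s : Finset (stateSpace ι)) (w : stateSpace ι → ℝ) (A : Op ι) :
    (∑ x ∈ s, w x • (x : Op ι →ₗ[ℂ] ℂ)) A = ∑ x ∈ s, (w x : ℂ) * (x : Op ι →ₗ[ℂ] ℂ) A := by
  rw [LinearMap.sum_apply]
  rfl

/-- Positive and negative parts of the weights have equal total mass, as evaluation at `1` shows;
after normalisation they are two convex combinations of the same state. -/
theorem IsAffineAutomorphism.sum_eq_zero_of_real {Φ : stateSpace ι → stateSpace ι}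
    (hΦ : IsAffineAutomorphism Φ) {s : Finset (stateSpace ι)} {w : stateSpace ι → ℝ}
    (h : ∑ x ∈ s, w x • (x : Op ι →ₗ[ℂ] ℂ) = 0) :
    ∑ x ∈ s, w x • (Φ x : Op ι →ₗ[ℂ] ℂ) = 0 := by
  have e (w : stateSpace ι → ℝ) (f : stateSpace ι → Op ι →ₗ[ℂ] ℂ) : ∑ x ∈ s, w x • f x =
      ∑ x ∈ s, (w x)⁺ • f x - ∑ x ∈ s, (w x)⁻ • f x := by
    rw [← Finset.sum_sub_distrib]
    refine Finset.sum_congr rfl fun x _ => ?_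
    rw [← sub_smul, posPart_sub_negPart]
  have h1 : ∑ x ∈ s, w x = 0 := by
    have := LinearMap.congr_fun h 1
    rw [sum_real_smul_state_apply] at this
    simp only [(Subtype.property _ : _ ∈ stateSpace ι).2, mul_one] at this
    rw [LinearMap.zero_apply] at this
    exact_mod_cast this
  rw [e w] at h ⊢
  rw [sub_eq_zero] at h ⊢
  refine hΦ.sum_eq convex_stateSpace (fun x _ => posPart_nonneg _) (fun x _ => negPart_nonneg _)
    rfl ?_ h
  rw [eq_comm, ← sub_eq_zero, ← Finset.sum_sub_distrib, ← h1]
  exact Finset.sum_congr rfl fun x _ => posPart_sub_negPart _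

/-- States are real on positive matrices, so the real and imaginary parts of the coefficients each
give a real relation. -/
theorem IsAffineAutomorphism.sum_eq_zero_of_complex {Φ : stateSpace ι → stateSpace ι}
    (hΦ : IsAffineAutomorphism Φ) {s : Finset (stateSpace ι)} {c : stateSpace ι → ℂ}
    (h : ∑ x ∈ s, c x • (x : Op ι →ₗ[ℂ] ℂ) = 0) :
    ∑ x ∈ s, c x • (Φ x : Op ι →ₗ[ℂ] ℂ) = 0 := by
  have val {A : Op ι} (hA : A.PosSemidef) :
      (∑ x ∈ s, (c x).re * ((x : Op ι →ₗ[ℂ] ℂ) A).re = 0) ∧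
      (∑ x ∈ s, (c x).im * ((x : Op ι →ₗ[ℂ] ℂ) A).re = 0) := by
    have := LinearMap.congr_fun h A
    simp only [LinearMap.sum_apply, LinearMap.smul_apply, smul_eq_mul,
      LinearMap.zero_apply] at this
    rw [Finset.sum_congr rfl fun x _ => by rw [← state_apply_ofReal x hA]] at this
    constructor
    · simpa using congrArg Complex.re this
    · simpa using congrArg Complex.im this
  have real (w : stateSpace ι → ℝ) (hw : ∀ A : Op ι, A.PosSemidef →
      ∑ x ∈ s, w x * ((x : Op ι →ₗ[ℂ] ℂ) A).re = 0) :
      ∑ x ∈ s, w x • (x : Op ι →ₗ[ℂ] ℂ) = 0 := by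
    refine linearMap_ext_vecMulVec_star fun x => ?_
    have hx := posSemidef_vecMulVec_self_star x
    rw [sum_real_smul_state_apply, Finset.sum_congr rfl fun x _ => by
      rw [← state_apply_ofReal x hx], LinearMap.zero_apply]
    exact_mod_cast hw _ hx
  have h1 := hΦ.sum_eq_zero_of_real (real (fun x => (c x).re) fun A hA => (val hA).1)
  have h2 := hΦ.sum_eq_zero_of_real (real (fun x => (c x).im) fun A hA => (val hA).2)
  have e (x : stateSpace ι) : c x • (Φ x : Op ι →ₗ[ℂ] ℂ) =
      (c x).re • (Φ x : Op ι →ₗ[ℂ] ℂ) + Complex.I • ((c x).im • (Φ x : Op ι →ₗ[ℂ] ℂ)) := by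
    ext1 A
    change c x * _ = ((c x).re : ℂ) * _ + Complex.I * (((c x).im : ℂ) * _)
    conv_lhs => rw [← Complex.re_add_im (c x)]
    ring
  rw [Finset.sum_congr rfl fun x _ => e x, Finset.sum_add_distrib, ← Finset.smul_sum, h1, h2,
    smul_zero, add_zero]

theorem span_stateSpace : Submodule.span ℂ (stateSpace ι) = ⊤ := by
  rw [eq_top_iff]
  intro ω _
  have := mem_of_vecMulVec_star_mem
    (S := (Submodule.span ℂ (stateSpace ι)).comap traceFunctional) (fun x => ?_) (density ω)
  · rw [Submodule.mem_comap] at this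
    rwa [show traceFunctional (density ω) = ω by
      ext1 A; exact trace_density_mul ω A] at this
  · by_cases hx : x = 0
    · subst hx
      rw [zero_vecMulVec]
      exact Submodule.zero_mem _
    · obtain ⟨t, t0, -, y, hy, -, h⟩ := exists_normalized x hx
      have ht0 : (t : ℂ) ≠ 0 := by exact_mod_cast t0.ne'
      have : vecMulVec x (star x) = (t : ℂ) • vecMulVec y (star y) := by
        rw [h, smul_smul, mul_inv_cancel₀ ht0, one_smul]
      rw [this]
      refine Submodule.smul_mem _ _ (Submodule.subset_span ?_)
      exact traceFunctional_mem_stateSpace (posSemidef_vecMulVec_self_star _)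
        (by rw [trace_vecMulVec, hy])

/-- An affine automorphism of the state space extends to a linear bijection. -/
theorem IsAffineAutomorphism.exists_linear {Φ : stateSpace ι → stateSpace ι}
    (hΦ : IsAffineAutomorphism Φ) : ∃ L : (Op ι →ₗ[ℂ] ℂ) →ₗ[ℂ] (Op ι →ₗ[ℂ] ℂ),
      Function.Bijective L ∧ ∀ ω : stateSpace ι, L ω = Φ ω := by
  let S : (stateSpace ι →₀ ℂ) →ₗ[ℂ] (Op ι →ₗ[ℂ] ℂ) :=
    Finsupp.linearCombination ℂ fun ω : stateSpace ι => (ω : Op ι →ₗ[ℂ] ℂ)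
  let T : (stateSpace ι →₀ ℂ) →ₗ[ℂ] (Op ι →ₗ[ℂ] ℂ) :=
    Finsupp.linearCombination ℂ fun ω : stateSpace ι => (Φ ω : Op ι →ₗ[ℂ] ℂ)
  have hS : LinearMap.range S = ⊤ := by
    rw [Finsupp.range_linearCombination, Subtype.range_coe, span_stateSpace]
  -- The extension is `T` after any section `R` of `S`; it is well behaved because `ker S ≤ ker T`.
  obtain ⟨R, hR⟩ := S.exists_rightInverse_of_surjective hS
  have hker (f : stateSpace ι →₀ ℂ) (hf : S f = 0) : T f = 0 :=
    hΦ.sum_eq_zero_of_complex (s := f.support) (c := f) hf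
  have hL (ω : stateSpace ι) : (T ∘ₗ R) ω = Φ ω := by
    have h1 : S (R ω - Finsupp.single ω 1) = 0 := by
      rw [map_sub, ← LinearMap.comp_apply, hR]
      simp [S]
    have := hker _ h1
    rw [map_sub, sub_eq_zero] at this
    rw [LinearMap.comp_apply, this]
    simp [T]
  have hsurj : Function.Surjective (T ∘ₗ R) := by
    rw [← LinearMap.range_eq_top, eq_top_iff, ← span_stateSpace, Submodule.span_le]
    intro ω hω
    obtain ⟨τ, hτ⟩ := hΦ.1.2 ⟨ω, hω⟩
    exact ⟨τ, by rw [hL, hτ]⟩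
  exact ⟨T ∘ₗ R, ⟨LinearMap.injective_iff_surjective.2 hsurj, hsurj⟩, hL⟩

end Automorphism

/-! ### Unitary implementation of affine automorphisms -/

section Kadison

variable {ι : Type} [Fintype ι] [DecidableEq ι]

theorem linearMap_ext_density {V : Type*} [AddCommGroup V] [Module ℂ V] {f g : Op ι →ₗ[ℂ] V}
    (h : ∀ ω : stateSpace ι, f (density (ω : Op ι →ₗ[ℂ] ℂ)) = g (density (ω : Op ι →ₗ[ℂ] ℂ))) :
    f = g := by
  have : f ∘ₗ density.toLinearMap = g ∘ₗ density.toLinearMap :=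
    LinearMap.ext_on span_stateSpace fun ω hω => h ⟨ω, hω⟩
  ext1 ρ
  have h := LinearMap.congr_fun this (density.symm ρ)
  simpa using h

omit [DecidableEq ι] in
/-- A linear map that takes each `x x*` to a matrix of rank at most one does so for all `x y*`. -/
theorem isSimple_of_isSimple_diag {M : Op ι →ₗ[ℂ] Op ι}
    (h : ∀ x, IsSimple (M (vecMulVec x (star x)))) (x y : ι → ℂ) :
    IsSimple (M (vecMulVec x y)) := by
  set w := star y with hw
  have hy : y = star w := by rw [hw, star_star]
  rw [hy]
  have e (c : ℂ) : M (vecMulVec (x + c • w) (star (x + c • w))) =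
      M (vecMulVec x (star x)) + (c * star c) • M (vecMulVec w (star w)) +
        star c • M (vecMulVec x (star w)) + c • M (vecMulVec w (star x)) := by
    rw [← map_smul, ← map_smul, ← map_smul, ← map_add, ← map_add, ← map_add]
    congr 1
    ext i j
    simp only [vecMulVec_apply, Matrix.add_apply, Matrix.smul_apply, Pi.add_apply, Pi.smul_apply,
      Pi.star_apply, star_add, star_smul, smul_eq_mul]
    ring
  refine isSimple_of_minor fun i i' j j' => ?_
  have m (c d n : ℂ) (hd : star c = d) (hn : c * d = n) :=
    (hd ▸ hn ▸ hd ▸ e c ▸ h (x + c • w) : IsSimple (M (vecMulVec x (star x)) +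
      n • M (vecMulVec w (star w)) + d • M (vecMulVec x (star w)) +
      c • M (vecMulVec w (star x)))).minor i i' j j'
  have hI : Complex.I ^ 2 = -1 := Complex.I_sq
  have mP := (h x).minor i i' j j'
  have mQ := (h w).minor i i' j j'
  -- Averaging the minors at `c` and `-c` leaves `|c|² (k + u) + c̄² z + c² z' = 0`. The values `c =
  -- 1, I, 1 + I` give `z + z' = 0` and `z = z'`, so the minor `z` vanishes.
  have m1 := m 1 1 1 (by simp) (by simp)
  have m2 := m (-1) (-1) 1 (by simp) (by simp)
  have m3 := m Complex.I (-Complex.I) 1 (by simp) (by simp)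
  have m4 := m (-Complex.I) Complex.I 1 (by simp) (by simp)
  have m5 := m (1 + Complex.I) (1 - Complex.I) 2 (by simp [sub_eq_add_neg])
    (by linear_combination -hI)
  have m6 := m (-1 - Complex.I) (-1 + Complex.I) 2 (by simp [sub_eq_add_neg])
    (by linear_combination -hI)
  simp only [Matrix.add_apply, Matrix.smul_apply, smul_eq_mul] at m1 m2 m3 m4 m5 m6
  generalize M (vecMulVec x (star x)) = P at *
  generalize M (vecMulVec w (star w)) = Q at *
  generalize M (vecMulVec x (star w)) = Z at *
  generalize M (vecMulVec w (star x)) = Z' at *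
  generalize Complex.I = I at *
  obtain ⟨z, hz⟩ : ∃ z, z = Z i j * Z i' j' - Z i j' * Z i' j := ⟨_, rfl⟩
  obtain ⟨z', hz'⟩ : ∃ z, z = Z' i j * Z' i' j' - Z' i j' * Z' i' j := ⟨_, rfl⟩
  obtain ⟨u, hu⟩ : ∃ u, u = Z i j * Z' i' j' + Z' i j * Z i' j' - Z i j' * Z' i' j
    - Z' i j' * Z i' j := ⟨_, rfl⟩
  obtain ⟨k, hk⟩ : ∃ k, k = P i j * Q i' j' + Q i j * P i' j' - P i j' * Q i' j
    - Q i j' * P i' j := ⟨_, rfl⟩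
  have h1 : k + u + z + z' = 0 := by
    rw [hz, hz', hu, hk]
    linear_combination (m1 + m2) / 2 - mP - mQ
  have h2 : k + u - z - z' = 0 := by
    have : k - I ^ 2 * u + I ^ 2 * z + I ^ 2 * z' = 0 := by
      rw [hz, hz', hu, hk]
      linear_combination (m3 + m4) / 2 - mP - mQ
    linear_combination this - (z + z' - u) * hI
  have h3 : 2 * k + 2 * u - 2 * I * z + 2 * I * z' = 0 := by
    have : 2 * k + (1 - I ^ 2) * u + (1 - I) ^ 2 * z + (1 + I) ^ 2 * z' = 0 := by
      rw [hz, hz', hu, hk]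
      linear_combination (m5 + m6) / 2 - mP - 4 * mQ
    linear_combination this - (z + z' - u) * hI
  rw [← sub_eq_zero, ← hz]
  linear_combination (h1 - h2) / 4 + I / 4 * (h3 - h1 - h2) + (z - z') / 2 * hI

theorem exists_matrix_of_isSimple [Nonempty ι] {M : Op ι →ₗ[ℂ] Op ι} (hM : Function.Bijective M)
    (h : ∀ x y, IsSimple (M (vecMulVec x y))) :
    ∃ A B : Op ι, (∀ ρ, M ρ = A * ρ * B) ∨ (∀ ρ, M ρ = A * ρᵀ * B) := by
  rcases simple_preserver hM h with ⟨A, B, hAB⟩ | ⟨A, B, hAB⟩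
  · refine ⟨LinearMap.toMatrix' A, (LinearMap.toMatrix' B)ᵀ, .inl fun ρ => ?_⟩
    let N : Op ι →ₗ[ℂ] Op ι :=
      LinearMap.mulRight ℂ (LinearMap.toMatrix' B)ᵀ ∘ₗ LinearMap.mulLeft ℂ (LinearMap.toMatrix' A)
    have : M = N := linearMap_ext_vecMulVec fun x y => by
      simp [N, hAB, mul_vecMulVec, vecMulVec_mul, vecMul_transpose]
    rw [this]
    rfl
  · refine ⟨LinearMap.toMatrix' B, (LinearMap.toMatrix' A)ᵀ, .inr fun ρ => ?_⟩
    let N : Op ι →ₗ[ℂ] Op ι :=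
      LinearMap.mulRight ℂ (LinearMap.toMatrix' A)ᵀ ∘ₗ
        LinearMap.mulLeft ℂ (LinearMap.toMatrix' B) ∘ₗ transposeOp ι
    have : M = N := linearMap_ext_vecMulVec fun x y => by
      simp [N, hAB, transposeOp, mul_vecMulVec, vecMulVec_mul, vecMul_transpose]
    rw [this]
    rfl

/-- Trace invariance gives `B A = 1`. Compatibility with adjoints makes `Aᴴ A` central, hence a
positive scalar `c`, and `A / √c` is unitary. -/
theorem exists_unitary_of_mul_mul [Nonempty ι] {A B : Op ι}
    (ht : ∀ ρ : Op ι, trace (A * ρ * B) = trace ρ)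
    (hh : ∀ ρ : Op ι, A * ρᴴ * B = (A * ρ * B)ᴴ) :
    ∃ W ∈ unitaryGroup ι ℂ, ∀ ρ : Op ι, A * ρ * B = W * ρ * Wᴴ := by
  have hBA : B * A = 1 := by
    apply ext_iff_trace_mul_right.2
    intro ρ
    rw [one_mul, ← ht ρ, mul_assoc, trace_mul_comm]
  have hAB : A * B = 1 := mul_eq_one_comm.1 hBA
  have hcomm (σ : Op ι) : Aᴴ * A * σ = σ * (Aᴴ * A) := by
    have := hh σᴴ
    rw [conjTranspose_conjTranspose, conjTranspose_mul, conjTranspose_mul,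
      conjTranspose_conjTranspose] at this
    calc Aᴴ * A * σ = Aᴴ * (A * σ * B) * A := by
          simp only [mul_assoc, hBA, mul_one]
      _ = (B * A)ᴴ * σ * (Aᴴ * A) := by
          rw [this, conjTranspose_mul]
          simp only [mul_assoc]
      _ = _ := by rw [hBA, conjTranspose_one, one_mul]
  obtain ⟨c, hc⟩ := mem_range_scalar_iff_commute_single'.2 fun i j => (hcomm (single i j 1)).symm
  have hAA : Aᴴ * A = c • (1 : Op ι) := by
    rw [← hc, scalar_apply, smul_one_eq_diagonal]
  obtain ⟨i⟩ := ‹Nonempty ι›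
  have hc0 : 0 ≤ c := by
    have := (posSemidef_conjTranspose_mul_self A).diag_nonneg (i := i)
    rw [hAA] at this
    simpa using this
  have hc1 : c ≠ 0 := by
    rintro rfl
    rw [zero_smul, conjTranspose_mul_self_eq_zero] at hAA
    rw [hAA, mul_zero] at hBA
    exact zero_ne_one hBA
  have hcr : c = (c.re : ℂ) := Complex.ext rfl (by simp [← (Complex.nonneg_iff.1 hc0).2])
  have hre : 0 ≤ c.re := (Complex.nonneg_iff.1 hc0).1
  set s : ℂ := ((Real.sqrt c.re : ℝ) : ℂ)
  have hss : s * s = c := by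
    rw [hcr, ← Complex.ofReal_mul, Real.mul_self_sqrt hre]
  have hstar : star (s⁻¹) = s⁻¹ := by
    simp [s]
  have hinv : s⁻¹ * s⁻¹ * c = 1 := by
    rw [← mul_inv, hss, inv_mul_cancel₀ hc1]
  have hB : (s⁻¹ * s⁻¹) • Aᴴ = B := by
    have : Aᴴ = c • B := by
      calc Aᴴ = Aᴴ * A * B := by rw [mul_assoc, hAB, mul_one]
        _ = c • B := by rw [hAA, smul_mul_assoc, one_mul]
    rw [this, smul_smul, hinv, one_smul]
  refine ⟨s⁻¹ • A, ?_, fun ρ => ?_⟩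
  · rw [mem_unitaryGroup_iff', star_eq_conjTranspose, conjTranspose_smul, hstar, smul_mul_smul_comm,
      hAA, smul_smul, hinv, one_smul]
  · rw [conjTranspose_smul, hstar, smul_mul_assoc, smul_mul_smul_comm, ← hB, mul_smul_comm]

/-- Affine automorphisms of the state space are implemented by unitaries, up to transposition. -/
theorem IsAffineAutomorphism.exists_unitary [Nonempty ι] {Φ : stateSpace ι → stateSpace ι}
    (hΦ : IsAffineAutomorphism Φ) : ∃ W ∈ unitaryGroup ι ℂ,
      (∀ ω A, (Φ ω : Op ι →ₗ[ℂ] ℂ) A = (ω : Op ι →ₗ[ℂ] ℂ) (Wᴴ * A * W)) ∨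
      (∀ ω A, (Φ ω : Op ι →ₗ[ℂ] ℂ) A = (ω : Op ι →ₗ[ℂ] ℂ) (Wᴴ * A * W)ᵀ) := by
  obtain ⟨L, hLb, hL⟩ := hΦ.exists_linear
  obtain ⟨M, hMb, hM⟩ : ∃ M : Op ι →ₗ[ℂ] Op ι, Function.Bijective M ∧ ∀ ω : stateSpace ι,
      M (density (ω : Op ι →ₗ[ℂ] ℂ)) = density (Φ ω : Op ι →ₗ[ℂ] ℂ) :=
    ⟨density.toLinearMap ∘ₗ L ∘ₗ density.symm.toLinearMap,
      density.bijective.comp (hLb.comp density.symm.bijective), fun ω => by simp [hL]⟩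
  have htr (ρ : Op ι) : trace (M ρ) = trace ρ := by
    have : traceLinearMap ι ℂ ℂ ∘ₗ M = traceLinearMap ι ℂ ℂ := linearMap_ext_density fun ω => by
      simp only [LinearMap.comp_apply, hM, traceLinearMap_apply]
      rw [(mem_stateSpace_iff.1 (Φ ω).2).2, (mem_stateSpace_iff.1 ω.2).2]
    exact LinearMap.congr_fun this ρ
  have hherm (ρ : Op ι) : M ρᴴ = (M ρ)ᴴ := by
    let M' : Op ι →ₗ[ℂ] Op ι :=
      { toFun := fun ρ => (M ρᴴ)ᴴ
        map_add' := fun ρ σ => by simp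
        map_smul' := fun c ρ => by simp }
    have : M' = M := linearMap_ext_density fun ω => by
      change (M (density _)ᴴ)ᴴ = _
      rw [(mem_stateSpace_iff.1 ω.2).1.isHermitian.eq, hM,
        (mem_stateSpace_iff.1 (Φ ω).2).1.isHermitian.eq]
    have h : (M ρᴴ)ᴴ = M ρ := LinearMap.congr_fun this ρ
    rw [← h, conjTranspose_conjTranspose]
  have hsimple (x : ι → ℂ) : IsSimple (M (vecMulVec x (star x))) := by
    by_cases hx : x = 0
    · exact ⟨0, 0, by rw [hx, zero_vecMulVec, map_zero, zero_vecMulVec]⟩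
    obtain ⟨t, t0, -, y, hy, -, h⟩ := exists_normalized x hx
    have ht0 : (t : ℂ) ≠ 0 := by exact_mod_cast t0.ne'
    have hxy : vecMulVec x (star x) = (t : ℂ) • vecMulVec y (star y) := by
      rw [h, smul_smul, mul_inv_cancel₀ ht0, one_smul]
    have hω : traceFunctional (vecMulVec y (star y)) ∈ stateSpace ι :=
      traceFunctional_mem_stateSpace (posSemidef_vecMulVec_self_star _)
        (by rw [trace_vecMulVec, hy])
    -- Vector states are the extreme states, so Φ sends them to vector states.
    obtain ⟨a, ha⟩ := exists_density_of_mem_extremePoints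
      (hΦ.mem_extremePoints (x := ⟨_, hω⟩) convex_stateSpace
        (mem_extremePoints_of_density hω (density_traceFunctional _)))
    have := hM ⟨_, hω⟩
    rw [density_traceFunctional, ha] at this
    exact ⟨(t : ℂ) • a, star a, by rw [hxy, map_smul, this, smul_vecMulVec]⟩
  obtain ⟨A, B, h | h⟩ := exists_matrix_of_isSimple hMb (isSimple_of_isSimple_diag hsimple)
  · obtain ⟨W, hW, e⟩ := exists_unitary_of_mul_mul (A := A) (B := B)
      (fun ρ => by rw [← h, htr]) (fun ρ => by rw [← h, ← h, hherm])
    refine ⟨W, hW, .inl fun ω X => ?_⟩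
    rw [← trace_density_mul, ← trace_density_mul, ← hM, h, e]
    rw [mul_assoc, mul_assoc, trace_mul_comm]
    simp only [mul_assoc]
  · obtain ⟨W, hW, e⟩ := exists_unitary_of_mul_mul (A := A) (B := B)
      (fun ρ => by
        have := htr ρᵀ
        rwa [h, transpose_transpose, trace_transpose] at this)
      (fun ρ => by
        have := hherm ρᵀ
        rwa [h, h, transpose_transpose, show (ρᵀᴴ)ᵀ = ρᴴ from rfl] at this)
    refine ⟨W, hW, .inr fun ω X => ?_⟩
    rw [← trace_density_mul, ← trace_density_mul, ← hM, h, e, ← trace_transpose (_ * (_)ᵀ),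
      transpose_mul, transpose_transpose]
    rw [mul_assoc, mul_assoc, trace_mul_comm, trace_mul_comm _ (density _)ᵀ]
    simp only [mul_assoc]

end Kadison

/-! ### Product vectors and local unitaries -/

section Product

variable {m n : ℕ}

theorem density_of_product {ω : Op (Fin m × Fin n) →ₗ[ℂ] ℂ} {ω₁ : Op (Fin m) →ₗ[ℂ] ℂ}
    {ω₂ : Op (Fin n) →ₗ[ℂ] ℂ}
    (h : ∀ (A : Op (Fin m)) (B : Op (Fin n)), ω (A ⊗ₖ B) = ω₁ A * ω₂ B) :
    density ω = density ω₁ ⊗ₖ density ω₂ := by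
  rw [← density_traceFunctional (density ω₁ ⊗ₖ density ω₂)]
  congr 1
  apply Matrix.ext_linearMap
  rintro ⟨i, j⟩ ⟨k, l⟩
  ext1
  have e : single (i, j) (k, l) (1 : ℂ) = single i k (1 : ℂ) ⊗ₖ single j l (1 : ℂ) := by
    rw [single_kronecker_single, mul_one]
  simp only [LinearMap.comp_apply, singleLinearMap_apply]
  rw [e, h, traceFunctional_apply, ← mul_kronecker_mul, trace_kronecker, trace_density_mul,
    trace_density_mul]

theorem productStates_subset : productStates m n ⊆ stateSpace (Fin m × Fin n) := by
  rintro ω ⟨ω₁, h₁, ω₂, h₂, h⟩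
  obtain ⟨p₁, t₁⟩ := mem_stateSpace_iff.1 h₁
  obtain ⟨p₂, t₂⟩ := mem_stateSpace_iff.1 h₂
  rw [mem_stateSpace_iff, density_of_product h, trace_kronecker, t₁, t₂, mul_one]
  exact ⟨p₁.kronecker p₂, rfl⟩

/-- The vector `x ⊗ y`. -/
def tensorVec (x : Fin m → ℂ) (y : Fin n → ℂ) : Fin m × Fin n → ℂ := fun p => x p.1 * y p.2

theorem vecMulVec_tensorVec (x : Fin m → ℂ) (y : Fin n → ℂ) :
    vecMulVec (tensorVec x y) (star (tensorVec x y)) =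
      vecMulVec x (star x) ⊗ₖ vecMulVec y (star y) := by
  ext p q
  simp only [vecMulVec_apply, kroneckerMap_apply, tensorVec, Pi.star_apply, star_mul']
  ring

theorem tensorVec_state_mem_productStates {x : Fin m → ℂ} {y : Fin n → ℂ}
    (hx : x ⬝ᵥ star x = 1) (hy : y ⬝ᵥ star y = 1) :
    traceFunctional (vecMulVec (tensorVec x y) (star (tensorVec x y))) ∈ productStates m n := by
  refine ⟨traceFunctional (vecMulVec x (star x)), traceFunctional_mem_stateSpace
    (posSemidef_vecMulVec_self_star _) (by rw [trace_vecMulVec, hx]),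
    traceFunctional (vecMulVec y (star y)), traceFunctional_mem_stateSpace
    (posSemidef_vecMulVec_self_star _) (by rw [trace_vecMulVec, hy]), fun A B => ?_⟩
  simp only [traceFunctional_apply]
  rw [vecMulVec_tensorVec, ← mul_kronecker_mul, trace_kronecker]

/-- A separable vector state is given by a product vector. -/
theorem isSimple_of_separable {ω : Op (Fin m × Fin n) →ₗ[ℂ] ℂ} (hω : ω ∈ separableStates m n)
    {φ : Fin m × Fin n → ℂ} (hφ : density ω = vecMulVec φ (star φ)) :
    IsSimple (of fun i j => φ (i, j)) := by
  have hsub : separableStates m n ⊆ stateSpace (Fin m × Fin n) :=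
    convexHull_min productStates_subset convex_stateSpace
  -- Extreme among all states, `ω` is extreme in the convex hull of the product states, hence is one
  -- of them.
  have hext := inter_extremePoints_subset_extremePoints_of_subset hsub
    ⟨hω, mem_extremePoints_of_density (hsub hω) hφ⟩
  obtain ⟨ω₁, -, ω₂, -, h⟩ := extremePoints_convexHull_subset hext
  have e := (hφ.symm.trans (density_of_product h))
  by_cases h0 : φ = 0
  · exact ⟨0, 0, by ext; simp [h0, vecMulVec_apply]⟩
  obtain ⟨⟨k, l⟩, hkl⟩ := Function.ne_iff.1 h0
  have hkl' : star (φ (k, l)) ≠ 0 := star_ne_zero.2 hkl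
  -- One column of `φ φ* = density ω₁ ⊗ density ω₂`, at an index where `φ` is nonzero, exhibits `φ`
  -- as a product.
  refine ⟨fun i => density ω₁ i k, fun j => density ω₂ j l / star (φ (k, l)), ?_⟩
  ext i j
  have := congrFun (congrFun e (i, j)) (k, l)
  simp only [vecMulVec_apply, Pi.star_apply, kroneckerMap_apply] at this
  simp only [of_apply, vecMulVec_apply]
  field_simp
  exact this

/-- The action of an operator on `ℂ^m ⊗ ℂ^n` in matrix form. -/
def tensorAction (W : Op (Fin m × Fin n)) :
    Matrix (Fin m) (Fin n) ℂ →ₗ[ℂ] Matrix (Fin m) (Fin n) ℂ where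
  toFun X := of fun i j => (W *ᵥ fun p => X p.1 p.2) (i, j)
  map_add' X Y := by
    ext i j
    exact congrFun (mulVec_add W (fun p => X p.1 p.2) (fun p => Y p.1 p.2)) (i, j)
  map_smul' c X := by
    ext i j
    exact congrFun (mulVec_smul W c (fun p => X p.1 p.2)) (i, j)

theorem tensorAction_vecMulVec (W : Op (Fin m × Fin n)) (x : Fin m → ℂ) (y : Fin n → ℂ) :
    tensorAction W (vecMulVec x y) = of fun i j => (W *ᵥ tensorVec x y) (i, j) := rfl

theorem tensorAction_single (W : Op (Fin m × Fin n)) (i k : Fin m) (j l : Fin n) :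
    tensorAction W (vecMulVec (Pi.single k 1) (Pi.single l 1)) i j = W (i, j) (k, l) := by
  have : tensorVec (Pi.single k 1) (Pi.single l 1) = Pi.single (k, l) (1 : ℂ) := by
    ext ⟨a, b⟩
    simp [tensorVec, Pi.single_apply, ← ite_and, and_comm]
  rw [tensorAction_vecMulVec, this, mulVec_single_one]
  rfl

theorem tensorAction_bijective {W : Op (Fin m × Fin n)} (hW : W ∈ unitaryGroup (Fin m × Fin n) ℂ) :
    Function.Bijective (tensorAction W) := by
  have hinj : Function.Injective (tensorAction W) := by
    intro X Y h
    have h' : W *ᵥ (fun p => X p.1 p.2) = W *ᵥ (fun p => Y p.1 p.2) := by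
      ext ⟨i, j⟩
      exact congrFun (congrFun h i) j
    have h2 := congrArg (fun v => star W *ᵥ v) h'
    simp only [mulVec_mulVec, mem_unitaryGroup_iff'.1 hW, one_mulVec] at h2
    ext i j
    exact congrFun h2 (i, j)
  exact ⟨hinj, LinearMap.injective_iff_surjective.1 hinj⟩

/-- The vector state of `x ⊗ y` is sent to that of `W (x ⊗ y)`. The latter is separable, so its
vector is a product. -/
theorem tensorAction_isSimple {Φ : stateSpace (Fin m × Fin n) → stateSpace (Fin m × Fin n)}
    (hΦ : PreservesSeparability Φ) {W : Op (Fin m × Fin n)}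
    (h : ∀ ω A, (Φ ω : Op (Fin m × Fin n) →ₗ[ℂ] ℂ) A =
      (ω : Op (Fin m × Fin n) →ₗ[ℂ] ℂ) (Wᴴ * A * W)) (x : Fin m → ℂ) (y : Fin n → ℂ) :
    IsSimple (tensorAction W (vecMulVec x y)) := by
  by_cases hxy : vecMulVec x y = 0
  · rw [hxy, map_zero]
    exact ⟨0, 0, by ext; simp [vecMulVec_apply]⟩
  obtain ⟨hx, hy⟩ := ne_zero_of_vecMulVec_ne_zero hxy
  obtain ⟨-, -, -, x, hx1, ⟨c, rfl⟩, -⟩ := exists_normalized x hx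
  obtain ⟨-, -, -, y, hy1, ⟨d, rfl⟩, -⟩ := exists_normalized y hy
  have hp := tensorVec_state_mem_productStates hx1 hy1
  have hs := hΦ ⟨_, productStates_subset hp⟩ (subset_convexHull ℝ _ hp)
  obtain ⟨a, b, hab⟩ := isSimple_of_separable hs (φ := W *ᵥ tensorVec x y) (by
    refine Eq.trans ?_ (density_traceFunctional _)
    congr 1
    ext1 A
    rw [h, traceFunctional_apply, traceFunctional_apply, star_mulVec, ← vecMulVec_mul,
      ← mul_vecMulVec, mul_assoc, mul_assoc, mul_assoc W, trace_mul_comm W]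
    simp only [mul_assoc])
  refine ⟨c • a, d • b, ?_⟩
  rw [smul_vecMulVec, vecMulVec_smul, map_smul, map_smul, tensorAction_vecMulVec, hab,
    smul_vecMulVec, vecMulVec_smul]

/-- The factors are unitary only up to reciprocal scalars. A diagonal entry `β` of `Bᴴ B` measures
the discrepancy, and `√β` is moved from `B` to `A`. -/
theorem exists_unitary_factors [NeZero m] [NeZero n] {A : Op (Fin m)} {B : Op (Fin n)}
    (h : A ⊗ₖ B ∈ unitaryGroup (Fin m × Fin n) ℂ) :
    ∃ (U : unitaryGroup (Fin m) ℂ) (V : unitaryGroup (Fin n) ℂ),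
      (U : Op (Fin m)) ⊗ₖ (V : Op (Fin n)) = A ⊗ₖ B := by
  rw [mem_unitaryGroup_iff', star_eq_conjTranspose, conjTranspose_kronecker,
    ← mul_kronecker_mul] at h
  have e (i k : Fin m) (j l : Fin n) : (Aᴴ * A) i k * (Bᴴ * B) j l =
      (1 : Op (Fin m)) i k * (1 : Op (Fin n)) j l := by
    rw [← one_kronecker_one] at h
    exact congrFun (congrFun h (i, j)) (k, l)
  have hβ := (posSemidef_conjTranspose_mul_self B).diag_nonneg (i := 0)
  have h00 := e 0 0 0 0
  have h1 (i k) := e i k 0 0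
  have h2 (j l) := e 0 0 j l
  simp only [one_apply_eq, mul_one, one_mul] at h00 h1 h2
  set β := (Bᴴ * B) 0 0
  have hβ0 : β ≠ 0 := by
    intro hz
    rw [hz, mul_zero] at h00
    exact zero_ne_one h00
  have hβr : β = (β.re : ℂ) := Complex.ext rfl (by simp [← (Complex.nonneg_iff.1 hβ).2])
  set s : ℂ := ((Real.sqrt β.re : ℝ) : ℂ) with hs
  have hss : s * s = β := by
    rw [hβr, hs, ← Complex.ofReal_mul, Real.mul_self_sqrt (Complex.nonneg_iff.1 hβ).1]
  have hs0 : s ≠ 0 := by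
    intro hz
    rw [hz, mul_zero] at hss
    exact hβ0 hss.symm
  have hstar : star s = s := by simp [s]
  refine ⟨⟨s • A, ?_⟩, ⟨s⁻¹ • B, ?_⟩, ?_⟩
  · rw [mem_unitaryGroup_iff', star_eq_conjTranspose, conjTranspose_smul, hstar,
      smul_mul_smul_comm, hss]
    ext i k
    rw [Matrix.smul_apply, smul_eq_mul, mul_comm, h1]
  · rw [mem_unitaryGroup_iff', star_eq_conjTranspose, conjTranspose_smul, star_inv₀, hstar,
      smul_mul_smul_comm, ← mul_inv, hss]
    ext j l
    rw [Matrix.smul_apply, smul_eq_mul, ← h2, ← eq_inv_of_mul_eq_one_left h00]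
  · rw [smul_kronecker, kronecker_smul, smul_smul, mul_inv_cancel₀ hs0, one_smul]

theorem isLocalComposition_of_kronecker [NeZero m] [NeZero n]
    {Φ : stateSpace (Fin m × Fin n) → stateSpace (Fin m × Fin n)} {A : Op (Fin m)}
    {B : Op (Fin n)} (hW : A ⊗ₖ B ∈ unitaryGroup (Fin m × Fin n) ℂ)
    (h : ∀ ω X, (Φ ω : Op (Fin m × Fin n) →ₗ[ℂ] ℂ) X =
      (ω : Op (Fin m × Fin n) →ₗ[ℂ] ℂ) ((A ⊗ₖ B)ᴴ * X * (A ⊗ₖ B))) :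
    IsLocalComposition Φ := by
  obtain ⟨U, V, hUV⟩ := exists_unitary_factors hW
  -- `localConj` puts the adjoint on the right, Φ on the left, hence the stars.
  have : Φ = localConj (star U) (star V) := by
    funext ω
    ext1
    ext1 X
    rw [h]
    change _ = (ω : Op (Fin m × Fin n) →ₗ[ℂ] ℂ)
      (((U : Op (Fin m))ᴴ ⊗ₖ (V : Op (Fin n))ᴴ) * X * ((U : Op (Fin m))ᴴ ⊗ₖ (V : Op (Fin n))ᴴ)ᴴ)
    rw [← conjTranspose_kronecker, conjTranspose_conjTranspose, hUV]
  rw [this]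
  exact .conj _ _

theorem swapMap_swapMap (ω : stateSpace (Fin m × Fin m)) :
    swapMap (rfl : m = m) (swapMap rfl ω) = ω := by
  ext1
  ext1 A
  rfl

theorem transposeMap_transposeMap {ι : Type} [Fintype ι] [DecidableEq ι] (ω : stateSpace ι) :
    transposeMap ι (transposeMap ι ω) = ω := by
  ext1
  ext1 A
  rfl

theorem isLocalComposition_of_unitary [NeZero m] [NeZero n]
    {Φ : stateSpace (Fin m × Fin n) → stateSpace (Fin m × Fin n)} (hΦ : PreservesSeparability Φ)
    {W : Op (Fin m × Fin n)} (hW : W ∈ unitaryGroup (Fin m × Fin n) ℂ)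
    (h : ∀ ω A, (Φ ω : Op (Fin m × Fin n) →ₗ[ℂ] ℂ) A =
      (ω : Op (Fin m × Fin n) →ₗ[ℂ] ℂ) (Wᴴ * A * W)) : IsLocalComposition Φ := by
  have hb := tensorAction_bijective hW
  rcases simple_preserver hb (tensorAction_isSimple hΦ h) with ⟨A, B, hAB⟩ | ⟨A, B, hAB⟩
  · have : W = LinearMap.toMatrix' A ⊗ₖ LinearMap.toMatrix' B := by
      ext ⟨i, j⟩ ⟨k, l⟩
      rw [← tensorAction_single W i k j l, hAB]
      simp [vecMulVec_apply, LinearMap.toMatrix'_apply]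
    subst this
    exact isLocalComposition_of_kronecker hW h
  -- In the swapped case, injective maps `ℂ^m → ℂ^n` and `ℂ^n → ℂ^m` force `m = n`. Exchanging the
  -- row indices turns W into a Kronecker product, so `swapMap ∘ Φ` is local.
  · have hA : Function.Injective A := by
      rw [← LinearMap.ker_eq_bot, LinearMap.ker_eq_bot']
      intro x hx
      have h1 : tensorAction W (vecMulVec x 1) = tensorAction W (vecMulVec 0 1) := by
        rw [hAB, hAB, hx, map_zero]
      exact vecMulVec_left_injective one_ne_zero (hb.1 h1)
    have hB : Function.Injective B := by
      rw [← LinearMap.ker_eq_bot, LinearMap.ker_eq_bot']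
      intro x hx
      have h1 : tensorAction W (vecMulVec 1 x) = tensorAction W (vecMulVec 1 0) := by
        rw [hAB, hAB, hx, map_zero]
      exact vecMulVec_right_injective one_ne_zero (hb.1 h1)
    obtain rfl : m = n := by
      have h1 := LinearMap.finrank_le_finrank_of_injective hA
      have h2 := LinearMap.finrank_le_finrank_of_injective hB
      rw [Module.finrank_fin_fun, Module.finrank_fin_fun] at h1 h2
      exact le_antisymm h1 h2
    have hK : W.submatrix Prod.swap id = LinearMap.toMatrix' A ⊗ₖ LinearMap.toMatrix' B := by
      ext ⟨i, j⟩ ⟨k, l⟩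
      rw [submatrix_apply, Prod.swap_prod_mk, id, ← tensorAction_single W j k i l, hAB]
      simp [vecMulVec_apply, LinearMap.toMatrix'_apply, mul_comm]
    have hconj (X : Op (Fin m × Fin m)) : (W.submatrix Prod.swap id)ᴴ * X *
        W.submatrix Prod.swap id = Wᴴ * X.submatrix Prod.swap Prod.swap * W := by
      have e1 : (W.submatrix Prod.swap id)ᴴ * X =
          (Wᴴ * X.submatrix Prod.swap Prod.swap).submatrix id Prod.swap := by
        rw [submatrix_mul _ _ id Prod.swap Prod.swap Prod.swap_bijective, submatrix_submatrix,
          conjTranspose_submatrix, Prod.swap_swap_eq, submatrix_id_id]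
      rw [e1, ← submatrix_mul _ _ id Prod.swap id Prod.swap_bijective, submatrix_id_id]
    have hΨ : IsLocalComposition (swapMap (rfl : m = m) ∘ Φ) := by
      refine isLocalComposition_of_kronecker (A := LinearMap.toMatrix' A)
        (B := LinearMap.toMatrix' B) ?_ fun ω X => ?_
      · have h1 := hconj 1
        rw [mul_one, submatrix_one _ Prod.swap_injective, mul_one, ← star_eq_conjTranspose W,
          mem_unitaryGroup_iff'.1 hW] at h1
        rw [mem_unitaryGroup_iff', ← hK]
        exact h1
      · rw [← hK, hconj]
        exact h ω (X.submatrix Prod.swap Prod.swap)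
    have : Φ = swapMap (rfl : m = m) ∘ (swapMap (rfl : m = m) ∘ Φ) := by
      funext ω
      exact (swapMap_swapMap _).symm
    rw [this]
    exact .comp (.swap rfl) hΨ

end Product

/-! ### Generators preserve separability and entanglement; conclusion -/

section Generators

variable {m n : ℕ}

/-- Precomposition with `f` is linear, so it suffices to check the product states that generate the
hull. -/
theorem dualMap_preservesSeparability {f : Op (Fin m × Fin n) →ₗ[ℂ] Op (Fin m × Fin n)}
    (hf : ∀ A : Op (Fin m × Fin n), A.PosSemidef → (f A).PosSemidef) (h1 : f 1 = 1)
    (h : ∀ ω ∈ productStates m n, ω ∘ₗ f ∈ productStates m n) :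
    PreservesSeparability (dualMap f hf h1) := by
  let T : (Op (Fin m × Fin n) →ₗ[ℂ] ℂ) →ₗ[ℝ] (Op (Fin m × Fin n) →ₗ[ℂ] ℂ) :=
    { toFun := fun ω => ω ∘ₗ f
      map_add' := fun _ _ => rfl
      map_smul' := fun _ _ => rfl }
  have : separableStates m n ⊆ T ⁻¹' separableStates m n :=
    convexHull_min (fun ω hω => subset_convexHull ℝ _ (h ω hω))
      ((convex_convexHull ℝ _).linear_preimage T)
  exact fun ω hω => this hω

theorem localConj_preservesSeparability (U : unitaryGroup (Fin m) ℂ) (V : unitaryGroup (Fin n) ℂ) :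
    PreservesSeparability (localConj U V) := by
  refine dualMap_preservesSeparability _ _ ?_
  rintro ω ⟨ω₁, h₁, ω₂, h₂, h⟩
  have hU {ι : Type} [Fintype ι] [DecidableEq ι] (U : unitaryGroup ι ℂ) {ω : Op ι →ₗ[ℂ] ℂ}
      (hω : ω ∈ stateSpace ι) : ω ∘ₗ conjOp (U : Op ι) ∈ stateSpace ι :=
    (dualMap (conjOp (U : Op ι)) (fun _ hA => hA.mul_mul_conjTranspose_same _)
      (by
        change (U : Op ι) * 1 * (U : Op ι)ᴴ = 1
        rw [mul_one]
        exact mem_unitaryGroup_iff.1 U.2) ⟨ω, hω⟩).2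
  refine ⟨_, hU U h₁, _, hU V h₂, fun A B => ?_⟩
  simp only [LinearMap.comp_apply, ← h]
  congr 1
  change ((U : Op (Fin m)) ⊗ₖ (V : Op (Fin n))) * (A ⊗ₖ B) *
    ((U : Op (Fin m)) ⊗ₖ (V : Op (Fin n)))ᴴ =
      ((U : Op (Fin m)) * A * (U : Op (Fin m))ᴴ) ⊗ₖ ((V : Op (Fin n)) * B * (V : Op (Fin n))ᴴ)
  rw [conjTranspose_kronecker, ← mul_kronecker_mul, ← mul_kronecker_mul]

theorem transposeMap_preservesSeparability :
    PreservesSeparability (transposeMap (Fin m × Fin n)) := by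
  refine dualMap_preservesSeparability _ _ ?_
  rintro ω ⟨ω₁, h₁, ω₂, h₂, h⟩
  exact ⟨_, (transposeMap (Fin m) ⟨ω₁, h₁⟩).2, _, (transposeMap (Fin n) ⟨ω₂, h₂⟩).2,
    fun A B => h Aᵀ Bᵀ⟩

theorem swapMap_preservesSeparability : PreservesSeparability (swapMap (rfl : m = m)) := by
  refine dualMap_preservesSeparability _ _ ?_
  rintro ω ⟨ω₁, h₁, ω₂, h₂, h⟩
  refine ⟨ω₂, h₂, ω₁, h₁, fun A B => ?_⟩
  rw [LinearMap.comp_apply, swapOp_kronecker, h, mul_comm]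

theorem preservesEntanglement_of_leftInverse
    {Φ Ψ : stateSpace (Fin m × Fin n) → stateSpace (Fin m × Fin n)}
    (hΨ : PreservesSeparability Ψ) (h : ∀ ω, Ψ (Φ ω) = ω) : PreservesEntanglement Φ := by
  intro ω hω hs
  apply hω
  rw [← h ω]
  exact hΨ _ hs

theorem swapMap_preserves (h : m = n) :
    PreservesEntanglement (swapMap h) ∧ PreservesSeparability (swapMap h) := by
  subst h
  exact ⟨preservesEntanglement_of_leftInverse swapMap_preservesSeparability swapMap_swapMap,
    swapMap_preservesSeparability⟩

theorem localConj_star_localConj (U : unitaryGroup (Fin m) ℂ) (V : unitaryGroup (Fin n) ℂ)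
    (ω : stateSpace (Fin m × Fin n)) : localConj (star U) (star V) (localConj U V ω) = ω := by
  ext1
  ext1 A
  have hUV : ((U : Op (Fin m)) ⊗ₖ (V : Op (Fin n))) *
      ((U : Op (Fin m))ᴴ ⊗ₖ (V : Op (Fin n))ᴴ) = 1 := by
    rw [← mul_kronecker_mul, ← star_eq_conjTranspose, ← star_eq_conjTranspose,
      mem_unitaryGroup_iff.1 U.2, mem_unitaryGroup_iff.1 V.2, one_kronecker_one]
  change (ω : Op (Fin m × Fin n) →ₗ[ℂ] ℂ) (((U : Op (Fin m)) ⊗ₖ (V : Op (Fin n))) *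
    (((U : Op (Fin m))ᴴ ⊗ₖ (V : Op (Fin n))ᴴ) * A * ((U : Op (Fin m))ᴴ ⊗ₖ (V : Op (Fin n))ᴴ)ᴴ) *
    ((U : Op (Fin m)) ⊗ₖ (V : Op (Fin n)))ᴴ) = _
  rw [mul_assoc, mul_assoc, ← conjTranspose_mul, hUV, conjTranspose_one, mul_one, ← mul_assoc,
    hUV, one_mul]

theorem IsLocalComposition.preserves
    {Φ : stateSpace (Fin m × Fin n) → stateSpace (Fin m × Fin n)} (h : IsLocalComposition Φ) :
    PreservesEntanglement Φ ∧ PreservesSeparability Φ := by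
  induction h with
  | conj U V =>
    exact ⟨preservesEntanglement_of_leftInverse (localConj_preservesSeparability (star U) (star V))
      (localConj_star_localConj U V), localConj_preservesSeparability U V⟩
  | transpose =>
    exact ⟨preservesEntanglement_of_leftInverse transposeMap_preservesSeparability
      transposeMap_transposeMap, transposeMap_preservesSeparability⟩
  | swap h => exact swapMap_preserves h
  | comp _ _ h₁ h₂ =>
    exact ⟨fun ω hω => h₁.1 _ (h₂.1 _ hω), fun ω hω => h₁.2 _ (h₂.2 _ hω)⟩

theorem isEmpty_stateSpace {ι : Type} [Fintype ι] [DecidableEq ι] [IsEmpty ι] :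
    IsEmpty (stateSpace ι) := by
  refine ⟨fun ω => ?_⟩
  have := ω.2.2
  rw [Subsingleton.elim (1 : Op ι) 0, map_zero] at this
  exact zero_ne_one this

theorem isLocalComposition_of_preservesSeparability
    {Φ : stateSpace (Fin m × Fin n) → stateSpace (Fin m × Fin n)} (hΦ : IsAffineAutomorphism Φ)
    (hs : PreservesSeparability Φ) : IsLocalComposition Φ := by
  -- If m or n is zero there are no states, and Φ coincides with any generator.
  rcases isEmpty_or_nonempty (Fin m × Fin n) with he | ⟨⟨i, j⟩⟩
  · have := isEmpty_stateSpace (ι := Fin m × Fin n)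
    rw [show Φ = transposeMap _ from funext fun ω => isEmptyElim ω]
    exact .transpose
  have : NeZero m := ⟨fun h => (Fin.cast h i).elim0⟩
  have : NeZero n := ⟨fun h => (Fin.cast h j).elim0⟩
  obtain ⟨W, hW, h | h⟩ := hΦ.exists_unitary
  · exact isLocalComposition_of_unitary hs hW h
  -- Precomposing with the transpose, an involution that preserves separability, reduces to the
  -- unitary case.
  · have hΨ : IsLocalComposition (Φ ∘ transposeMap (Fin m × Fin n)) :=
      isLocalComposition_of_unitary (fun ω hω => hs _ (transposeMap_preservesSeparability ω hω)) hW
        fun ω A => h (transposeMap _ ω) A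
    have : Φ = (Φ ∘ transposeMap (Fin m × Fin n)) ∘ transposeMap (Fin m × Fin n) := by
      funext ω
      exact congrArg Φ (transposeMap_transposeMap ω).symm
    rw [this]
    exact .comp hΨ .transpose

end Generators

end SeparableStates

theorem corollary5p7 (m n : ℕ)
    (Φ : SeparableStates.stateSpace (Fin m × Fin n) → SeparableStates.stateSpace (Fin m × Fin n))
    (hΦ : SeparableStates.IsAffineAutomorphism Φ) :
    (SeparableStates.PreservesEntanglement Φ ∧ SeparableStates.PreservesSeparability Φ) ↔
      SeparableStates.IsLocalComposition Φ :=
  ⟨fun h => SeparableStates.isLocalComposition_of_preservesSeparability hΦ h.2,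
    fun h => h.preserves⟩
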